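/- Let $M$ be a non-negative integer $n\times n$ matrix without zero columns, in primitive Frobenius form: the index set $\{1,\dots,n\}$ is partitioned into non-empty blocks $B_1,\dots,B_r$ with respect to which $M$ is lower triangular, and each diagonal block of $M$ is primitive or is the $1\times1$ matrix $(0)$. The PF-eigenvalue $\lambda_i\ge 0$ of $B_i$ is the Perron–Frobenius eigenvalue (the largest real eigenvalue) of the $i$-th diagonal block $M_{i,i}$. Write $B_i\succ B_j$ if $i\ne j$ and, for some $t\ge1$, $M^t$ has a positive entry whose column lies in $B_i$ and whose row lies in $B_j$. The dependency block union $C(B_i)$ is the union of all $B_j$ with $B_i\succ B_j$. The block cone of a union $S$ of blocks is the set of non-negative vectors in $\mathbb R^n$ that vanish outside $S$. For a non-empty union $S$ of blocks that contains, with each block, all blocks below it for $\succ$, let $\lambda_S$ be the maximal PF-eigenvalue of a block in $S$ and $k_S$ the length of a longest $\succ$-chain of blocks in $S$ that all have PF-eigenvalue $\lambda_S$. The growth type function of $S$ is $h_S(t)=\lambda_S^t\,t^{k_S-1}$. The growth type function of a block $B$ is $h_{B\cup C(B)}$. The dominant interior of the cone $\mathcal S$ of $S$ consists of the vectors in $\mathcal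 S$ all of whose coordinates in the blocks of some such longest chain are non-zero. The cone $\mathcal S$ satisfies the convergence condition if $\lambda_S\ge1$ and, for every $u\in\mathcal S$, the sequence $\frac1{h_S(t)}M^tu$ converges as $t\to\infty$ to a vector that is either $0$ or an eigenvector of $M$ in $\mathcal S$, and is non-zero if $u$ lies in the dominant interior of $\mathcal S$. Let $B$ be a block whose dependency block union $C=C(B)$ is non-empty, let $\mathcal B$ and $\mathcal C$ be the cones of $B$ and $C$, let $\lambda$ be the PF-eigenvalue of $B$, let $\lambda_u=\lambda_C$, and let $h$ be the growth type function of $B$. Assume that $\mathcal C$ satisfies the convergence condition. Then for every non-zero $v_0\in\mathcal B$ the sequence $\frac1{h(t)}M^tv_0$ converges to an eigenvector $w_\infty=w_\infty(v_0)$ of $M$. Moreover, let $v_\infty$ be the extended PF-eigenvector of $B$, that is, the unique vector in $\mathcal B$ with $\sum_x|v_\infty(x)|=1$ whose restriction to $B$ is an eigenvector of the diagonal block of $B$ for the eigenvalue $\lambda$. Then: 1. If $\lambda>\lambda_u$, there is a unique vector $w_0\in\mathcal C$ (which does not depend on $v_0$) such that $v_\infty+w_0$ is an eigenvector of $M$ and,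 for every non-zero $v_0\in\mathcal B$, $w_\infty(v_0)=c\,(v_\infty+w_0)$ for some real $c=c(v_0)>0$. 2. If $\lambda=\lambda_u$, there is an eigenvector $u_\infty\in\mathcal C$ of $M$ (which does not depend on $v_0$) such that, for every non-zero $v_0\in\mathcal B$, $w_\infty(v_0)=c\,u_\infty$ for some real $c=c(v_0)>0$. 3. If $\lambda<\lambda_u$, then $w_\infty(v_0)$ is an eigenvector of $M$ lying in $\mathcal C$ for every non-zero $v_0\in\mathcal B$; it may depend on $v_0$. -/

import Mathlib

open Filter Topology

noncomputable section

namespace BlockFrobenius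

variable {n r : ℕ}

/-- `v` is an eigenvector of `M` (non-zero, for some real eigenvalue). -/
def IsEigenvector (M : Matrix (Fin n) (Fin n) ℝ) (v : Fin n → ℝ) : Prop :=
  ∃ μ : ℝ, Module.End.HasEigenvector (Matrix.toLin' M) μ v

/-- The Perron-Frobenius eigenvalue of a non-negative square matrix: its largest real
eigenvalue. For the `1 × 1` matrix with entry `0` its value is `0`. -/
def pfEigenvalue {κ : Type*} [Fintype κ] [DecidableEq κ] (A : Matrix κ κ ℝ) : ℝ :=
  sSup {μ : ℝ | Module.End.HasEigenvalue (Matrix.toLin' A) μ}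

/-- The matrix `M` is in primitive Frobenius form with respect to the partition of its index set
into the `r` blocks `{x | b x = i}`, `i : Fin r`: the blocks are non-empty, `M` is lower
triangular with respect to them, and each diagonal block is
primitive or is the `1 × 1` matrix with entry `0`. -/
structure IsPrimitiveFrobeniusForm (M : Matrix (Fin n) (Fin n) ℝ) (b : Fin n → Fin r) : Prop where
  surjective : Function.Surjective b
  lowerTriangular : ∀ x y, b x < b y → M x y = 0
  diagonal : ∀ i : Fin r, (M.toSquareBlock b i).IsPrimitive ∨
    (Fintype.card {x // b x = i} = 1 ∧ M.toSquareBlock b i = 0)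

/-- The PF-eigenvalue of the block `i`. -/
def blockPF (M : Matrix (Fin n) (Fin n) ℝ) (b : Fin n → Fin r) (i : Fin r) : ℝ :=
  pfEigenvalue (M.toSquareBlock b i)

/-- `Dominates M b i j` is the relation `B_i ≻ B_j`: the blocks differ, and for some `t ≥ 1` the
matrix `M ^ t` has a positive entry in block column `i` and block row `j`. -/
def Dominates (M : Matrix (Fin n) (Fin n) ℝ) (b : Fin n → Fin r) (i j : Fin r) : Prop :=
  i ≠ j ∧ ∃ t : ℕ, 1 ≤ t ∧ ∃ x y : Fin n, b x = j ∧ b y = i ∧ 0 < (M ^ t) x y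

/-- The dependency block union `C(B_i)`, as the set of the blocks `B_j` with `B_i ≻ B_j`. -/
def dependencyUnion (M : Matrix (Fin n) (Fin n) ℝ) (b : Fin n → Fin r) (i : Fin r) :
    Set (Fin r) :=
  {j | Dominates M b i j}

/-- The block cone of a union `S` of blocks: the non-negative vectors that have non-zero entries
only in the blocks of `S`. -/
def blockCone (b : Fin n → Fin r) (S : Set (Fin r)) : Set (Fin n → ℝ) :=
  {v | (∀ x, 0 ≤ v x) ∧ ∀ x, b x ∉ S → v x = 0}

/-- The maximal PF-eigenvalue among the blocks of `S` (for non-empty `S`). -/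
def maxPF (M : Matrix (Fin n) (Fin n) ℝ) (b : Fin n → Fin r) (S : Set (Fin r)) : ℝ :=
  sSup (blockPF M b '' S)

/-- `T` is a chain for `≻` of blocks of `S` that all have PF-eigenvalue `maxPF M b S`. -/
def IsTopChain (M : Matrix (Fin n) (Fin n) ℝ) (b : Fin n → Fin r) (S : Set (Fin r))
    (T : Finset (Fin r)) : Prop :=
  (T : Set (Fin r)) ⊆ S ∧ IsChain (Dominates M b) (T : Set (Fin r)) ∧
    ∀ j ∈ T, blockPF M b j = maxPF M b S

/-- The number of blocks in a longest chain in `S` of blocks with PF-eigenvalue `maxPF M b S`. -/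
def chainLength (M : Matrix (Fin n) (Fin n) ℝ) (b : Fin n → Fin r) (S : Set (Fin r)) : ℕ :=
  sSup {k : ℕ | ∃ T : Finset (Fin r), IsTopChain M b S T ∧ T.card = k}

/-- The growth type function `t ↦ λ ^ t * t ^ (k - 1)` of a union `S` of blocks, where `λ` is the
maximal PF-eigenvalue in `S` and `k` is the length of a longest chain in `S` of blocks with
PF-eigenvalue `λ`. For a set `S` that contains with a block all the blocks below it (a union of
blocks with invariant cone) this is the maximal one among the growth type functions of the
blocks of `S`, since a longest such chain lies below its top block. -/
def growthFun (M : Matrix (Fin n) (Fin n) ℝ) (b : Fin n → Fin r) (S : Set (Fin r)) (t : ℕ) : ℝ :=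
  maxPF M b S ^ t * (t : ℝ) ^ (chainLength M b S - 1)

/-- The growth type function of the block `i`, formed with all blocks `j` such that `i ⪰ j`. -/
def blockGrowthFun (M : Matrix (Fin n) (Fin n) ℝ) (b : Fin n → Fin r) (i : Fin r) : ℕ → ℝ :=
  growthFun M b (insert i (dependencyUnion M b i))

/-- The dominant interior of the block cone of `S`: the vectors of the cone all of whose
coordinates in the blocks of some longest chain as above are non-zero. -/
def dominantInterior (M : Matrix (Fin n) (Fin n) ℝ) (b : Fin n → Fin r) (S : Set (Fin r)) :
    Set (Fin n → ℝ) :=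
  {v | v ∈ blockCone b S ∧ ∃ T : Finset (Fin r), IsTopChain M b S T ∧
    T.card = chainLength M b S ∧ ∀ x, b x ∈ T → v x ≠ 0}

/-- The convergence condition for the block cone of a union `S` of blocks whose cone is invariant
under `M` (as it always is for a dependency block union): the exponential rate of the growth type
function is at least `1`, and for every `u` in the cone the sequence `M ^ t u / h(t)`, with `h` the
growth type function of `S`, converges to a vector which is an eigenvector of `M` in the cone or
zero, and which is not zero if `u` lies in the dominant interior. -/
def ConvergenceCondition (M : Matrix (Fin n) (Fin n) ℝ) (b : Fin n → Fin r) (S : Set (Fin r)) :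
    Prop :=
  1 ≤ maxPF M b S ∧
  ∀ u ∈ blockCone b S, ∃ w : Fin n → ℝ,
    Tendsto (fun t : ℕ => (growthFun M b S t)⁻¹ • (M ^ t).mulVec u) atTop (𝓝 w) ∧
    ((w ∈ blockCone b S ∧ IsEigenvector M w) ∨ w = 0) ∧
    (u ∈ dominantInterior M b S → w ≠ 0)

/-- `v` is the extended PF-eigenvector of the block `i`: a non-negative vector supported in the
block, of `ℓ¹`-norm `1`, whose restriction to the block is an eigenvector of the diagonal block
for its PF-eigenvalue. -/
def IsExtendedPFEigenvector (M : Matrix (Fin n) (Fin n) ℝ) (b : Fin n → Fin r) (i : Fin r)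
    (v : Fin n → ℝ) : Prop :=
  v ∈ blockCone b {i} ∧ ∑ x, |v x| = 1 ∧
    Module.End.HasEigenvector (Matrix.toLin' (M.toSquareBlock b i)) (blockPF M b i)
      (fun x => v x.1)

end BlockFrobenius

end

/-! Let `A` be the diagonal block of `B`, `R` the rest of its block column, and `ι` the inclusion of
the coordinates of `B`. Sorting mass by the time at which it leaves `B` gives the discrete Duhamel
formula `M^t ι u = ι A^t u + ∑_{s<t} M^(t-1-s) R A^s u` (`pow_mul_blockIncl`). The vectors `R A^s u`
lie in the cone of `C`, so only columns of `M^m` indexed by `C` act on them. By the convergence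
condition for unit vectors, these columns divided by `λ_u^m m^(k-1)` converge (`IsColumnLimit`).
Perron–Frobenius theory controls `A^s u`. Coordinatewise, what remains is the asymptotics of a
scalar convolution.

If `λ > λ_u`, then `λ^(-s) R A^s u` converges and the columns are summable against `λ^(-m)`, so the
limit is a multiple of `v∞ + ∑_m λ^(-m-1) M^m R v∞`. If `λ = λ_u`, summing `t` contributions of
order `t^(k-1)` gains one power of `t`; this is matched by the longest chain growing by the block
`B`, and the direction is that of the limit for `R v∞`. If `λ < λ_u`, the exits are summable against
`λ_u^(-s)`, and the limit is that of the single vector `z = ∑_s λ_u^(-s-1) R A^s u` of the cone of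
`C`. The convolution limits are `tendsto_convolution_of_summable` and
`tendsto_convolution_of_tendsto`.

In the last two cases the limit must be shown non-zero
(`ConvergenceCondition.columnLimit_isEigenvector`). The vector in question dominates a multiple of
`R v` with `v` positive on `B`, so a power of `M` makes it positive on a longest top chain, that is,
moves it into the dominant interior. Applying `M^p` only multiplies the limit by `λ_u^p`. -/

namespace BlockFrobenius

/-! ### Asymptotics of scalar convolutions. -/

section Convolution

open Finset

theorem tendsto_div_pow_add {G : ℕ → ℝ} {j : ℕ} {l : ℝ}
    (hG : Tendsto (fun m : ℕ => G m / (m : ℝ) ^ j) atTop (𝓝 l)) (a : ℝ) :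
    Tendsto (fun m : ℕ => G m / ((m : ℝ) + a) ^ j) atTop (𝓝 l) := by
  have h1 : Tendsto (fun m : ℕ => ((m : ℝ) / (m + a)) ^ j) atTop (𝓝 1) := by
    simpa using (tendsto_natCast_div_add_atTop a).pow j
  have h2 := hG.mul h1
  rw [mul_one] at h2
  refine h2.congr' ?_
  filter_upwards [eventually_gt_atTop 0] with m hm
  have : (m : ℝ) ^ j ≠ 0 := pow_ne_zero _ (by exact_mod_cast hm.ne')
  rw [div_pow, div_mul_div_cancel₀ this]

/-- A convergent sequence is bounded; comparing with `m + 1` instead of `m` keeps the bound valid at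
`m = 0`, where division by `m ^ j` may lose information. -/
theorem exists_abs_le_mul_add_one_pow {G : ℕ → ℝ} {j : ℕ} {l : ℝ}
    (hG : Tendsto (fun m : ℕ => G m / (m : ℝ) ^ j) atTop (𝓝 l)) :
    ∃ K : ℝ, ∀ m : ℕ, |G m| ≤ K * ((m : ℝ) + 1) ^ j := by
  obtain ⟨K, hK⟩ := (tendsto_div_pow_add hG 1).norm.bddAbove_range
  refine ⟨K, fun m => ?_⟩
  have h := hK ⟨m, rfl⟩
  have hp : (0 : ℝ) < ((m : ℝ) + 1) ^ j := by positivity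
  simp only [Real.norm_eq_abs, abs_div, abs_of_pos hp] at h
  exact (div_le_iff₀ hp).1 h

/-- Convolution of a summable sequence with one of growth `m ^ j`. -/
theorem tendsto_convolution_of_summable {F G : ℕ → ℝ} {j : ℕ} {l : ℝ} (hF : Summable F)
    (hG : Tendsto (fun m : ℕ => G m / (m : ℝ) ^ j) atTop (𝓝 l)) :
    Tendsto (fun t : ℕ => (∑ s ∈ range t, F s * G (t - 1 - s)) / (t : ℝ) ^ j) atTop
      (𝓝 ((∑' s, F s) * l)) := by
  obtain ⟨K, hK⟩ := exists_abs_le_mul_add_one_pow hG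
  -- Dominated convergence for series: extended by zero for `s ≥ t`, the `s`-th term tends to `F s *
  -- l` and is bounded by `|F s| * K`, since `(t - 1 - s) + 1 ≤ t`.
  have key := tendsto_tsum_of_dominated_convergence (𝓕 := atTop)
    (f := fun (t s : ℕ) => if s < t then F s * (G (t - 1 - s) / (t : ℝ) ^ j) else 0)
    (g := fun s => F s * l) (bound := fun s => |F s| * K) (hF.abs.mul_right K) ?_ ?_
  · rw [tsum_mul_right] at key
    refine key.congr fun t => ?_
    rw [tsum_eq_sum (s := range t), sum_div]
    · refine sum_congr rfl fun s hs => ?_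
      rw [if_pos (mem_range.1 hs), mul_div_assoc]
    · intro s hs
      rw [if_neg (by simpa using hs)]
  · intro s
    refine (tendsto_add_atTop_iff_nat (s + 1)).1 ?_
    refine ((tendsto_div_pow_add hG ((s : ℝ) + 1)).const_mul (F s)).congr fun m => ?_
    rw [if_pos (by omega), show m + (s + 1) - 1 - s = m by omega]
    push_cast
    rfl
  · filter_upwards [eventually_gt_atTop 0] with t ht s
    have ht' : (0 : ℝ) < (t : ℝ) ^ j := by positivity
    have hK0 : 0 ≤ K := by
      have := (abs_nonneg _).trans (hK 0)
      simpa using this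
    split_ifs with hs
    · rw [Real.norm_eq_abs, abs_mul, abs_div, abs_of_pos ht']
      refine mul_le_mul_of_nonneg_left ?_ (abs_nonneg _)
      rw [div_le_iff₀ ht']
      refine (hK _).trans (mul_le_mul_of_nonneg_left ?_ hK0)
      refine pow_le_pow_left₀ (by positivity) ?_ _
      have : t - 1 - s + 1 ≤ t := by omega
      exact_mod_cast this
    · simpa using mul_nonneg (abs_nonneg (F s)) hK0

theorem tendsto_pow_succ_sub_div (j : ℕ) :
    Tendsto (fun m : ℕ => (((m : ℝ) + 1) ^ (j + 1) - (m : ℝ) ^ (j + 1)) / (m : ℝ) ^ j) atTop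
      (𝓝 ((j : ℝ) + 1)) := by
  have h1 : Tendsto (fun m : ℕ => ((m : ℝ) + 1) / m) atTop (𝓝 1) := by
    have := (tendsto_natCast_div_add_atTop (1 : ℝ)).inv₀ one_ne_zero
    simpa using this
  have h2 : Tendsto (fun m : ℕ => ∑ i ∈ range (j + 1), (((m : ℝ) + 1) / m) ^ i) atTop
      (𝓝 (∑ i ∈ range (j + 1), (1 : ℝ) ^ i)) := tendsto_finsetSum _ fun i _ => h1.pow i
  simp only [one_pow, sum_const, card_range, nsmul_eq_mul, mul_one, Nat.cast_add,
    Nat.cast_one] at h2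
  refine h2.congr' ?_
  filter_upwards [eventually_gt_atTop 0] with m hm
  have hm' : (m : ℝ) ≠ 0 := by exact_mod_cast hm.ne'
  have h3 := geom_sum₂_mul ((m : ℝ) + 1) (m : ℝ) (j + 1)
  rw [← h3, add_sub_cancel_left, mul_one, sum_div]
  refine sum_congr rfl fun i hi => ?_
  have hij : i ≤ j := by have := mem_range.1 hi; omega
  rw [div_pow, div_eq_div_iff (pow_ne_zero _ hm') (pow_ne_zero _ hm'), mul_assoc, ← pow_add]
  congr 2
  omega

/-- Stolz–Cesàro: the increments `D m` of `m ^ (j + 1)` telescope and are asymptotic to `(j + 1) * m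
^ j`, so `G - c * D` is `o(D)`, and this passes to partial sums because those of `D` diverge. -/
theorem tendsto_sum_range_div_pow_succ {G : ℕ → ℝ} {j : ℕ} {l : ℝ}
    (hG : Tendsto (fun m : ℕ => G m / (m : ℝ) ^ j) atTop (𝓝 l)) :
    Tendsto (fun t : ℕ => (∑ m ∈ range t, G m) / (t : ℝ) ^ (j + 1)) atTop
      (𝓝 (l / ((j : ℝ) + 1))) := by
  set D : ℕ → ℝ := fun m => ((m : ℝ) + 1) ^ (j + 1) - (m : ℝ) ^ (j + 1) with hD
  have hDpos : ∀ m, 0 < D m := fun m => by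
    have : (m : ℝ) ^ (j + 1) < ((m : ℝ) + 1) ^ (j + 1) :=
      pow_lt_pow_left₀ (by linarith) (by positivity) (by omega)
    simp only [hD]; linarith
  have hDsum : ∀ t, ∑ m ∈ range t, D m = (t : ℝ) ^ (j + 1) := fun t => by
    have := sum_range_sub (fun m : ℕ => (m : ℝ) ^ (j + 1)) t
    simpa [hD] using this
  set c := l / ((j : ℝ) + 1) with hc
  have hj : ((j : ℝ) + 1) ≠ 0 := by positivity
  have hlit : (fun m => G m - c * D m) =o[atTop] D := by
    refine Asymptotics.isLittleO_of_tendsto (fun m h => absurd h (hDpos m).ne') ?_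
    have h1 := (hG.div (tendsto_pow_succ_sub_div j) hj).sub_const c
    rw [← hc, sub_self] at h1
    refine h1.congr' ?_
    filter_upwards [eventually_gt_atTop 0] with m hm
    have hm' : (m : ℝ) ^ j ≠ 0 := pow_ne_zero _ (by exact_mod_cast hm.ne')
    have := (hDpos m).ne'
    simp only [Pi.div_apply]
    rw [div_div_div_cancel_right₀ hm', sub_div, mul_div_cancel_right₀ _ this]
  have hs := hlit.sum_range (fun m => (hDpos m).le) ?_
  · have h2 := hs.tendsto_div_nhds_zero.add_const c
    rw [zero_add] at h2
    refine h2.congr' ?_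
    filter_upwards [eventually_gt_atTop 0] with t ht
    have ht' : (t : ℝ) ^ (j + 1) ≠ 0 := pow_ne_zero _ (by exact_mod_cast ht.ne')
    rw [sum_sub_distrib, ← mul_sum, hDsum, sub_div, mul_div_cancel_right₀ _ ht', sub_add_cancel]
  · simp only [hDsum]
    exact (tendsto_pow_atTop (by omega)).comp tendsto_natCast_atTop_atTop

/-- Convolution of a convergent sequence with one of growth `m ^ j`. -/
theorem tendsto_convolution_of_tendsto {F G : ℕ → ℝ} {j : ℕ} {φ l : ℝ}
    (hF : Tendsto F atTop (𝓝 φ))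
    (hG : Tendsto (fun m : ℕ => G m / (m : ℝ) ^ j) atTop (𝓝 l)) :
    Tendsto (fun t : ℕ => (∑ s ∈ range t, F s * G (t - 1 - s)) / (t : ℝ) ^ (j + 1)) atTop
      (𝓝 (φ * l / ((j : ℝ) + 1))) := by
  obtain ⟨K, hK⟩ := exists_abs_le_mul_add_one_pow hG
  have hK0 : 0 ≤ K := by
    have := (abs_nonneg _).trans (hK 0)
    simpa using this
  have h1 : Tendsto (fun t : ℕ => φ * ((∑ m ∈ range t, G m) / (t : ℝ) ^ (j + 1))) atTop
      (𝓝 (φ * l / ((j : ℝ) + 1))) := by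
    rw [mul_div_assoc]
    exact (tendsto_sum_range_div_pow_succ hG).const_mul φ
  -- The error from replacing `F` by its limit `φ` is bounded by a multiple of the Cesàro mean of
  -- `|F s - φ|`.
  have h2 : Tendsto (fun t : ℕ => (∑ s ∈ range t, (F s - φ) * G (t - 1 - s)) / (t : ℝ) ^ (j + 1))
      atTop (𝓝 0) := by
    have hc : Tendsto (fun s => |F s - φ|) atTop (𝓝 0) := by
      have := (hF.sub_const φ).abs
      simpa using this
    have hc2 := hc.cesaro.const_mul K
    rw [mul_zero] at hc2
    refine squeeze_zero_norm' ?_ hc2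
    filter_upwards [eventually_gt_atTop 0] with t ht
    have ht0 : (0 : ℝ) < t := by exact_mod_cast ht
    have ht' : (0 : ℝ) < (t : ℝ) ^ (j + 1) := by positivity
    rw [Real.norm_eq_abs, abs_div, abs_of_pos ht', div_le_iff₀ ht']
    calc |∑ s ∈ range t, (F s - φ) * G (t - 1 - s)|
        ≤ ∑ s ∈ range t, |F s - φ| * (K * (t : ℝ) ^ j) := by
          refine (abs_sum_le_sum_abs _ _).trans (sum_le_sum fun s hs => ?_)
          rw [abs_mul]
          refine mul_le_mul_of_nonneg_left ?_ (abs_nonneg _)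
          refine (hK _).trans (mul_le_mul_of_nonneg_left ?_ hK0)
          refine pow_le_pow_left₀ (by positivity) ?_ _
          have : t - 1 - s + 1 ≤ t := by have := mem_range.1 hs; omega
          exact_mod_cast this
      _ = K * ((t : ℝ)⁻¹ * ∑ s ∈ range t, |F s - φ|) * (t : ℝ) ^ (j + 1) := by
          rw [← sum_mul, pow_succ]
          field_simp
  have h3 := h1.add h2
  rw [add_zero] at h3
  refine h3.congr fun t => ?_
  rw [← sum_range_reflect G t, ← mul_div_assoc, ← add_div, mul_sum, ← sum_add_distrib]
  congr 1
  refine sum_congr rfl fun s _ => ?_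
  ring

end Convolution

/-! ### Perron–Frobenius theory of a primitive matrix. -/

section PerronFrobenius

variable {κ : Type*} [Fintype κ] [DecidableEq κ]

theorem mulVec_nonneg_of_nonneg {ι κ : Type*} [Fintype κ] {A : Matrix ι κ ℝ}
    (hA : ∀ x y, 0 ≤ A x y) {u : κ → ℝ}
    (hu : ∀ y, 0 ≤ u y) (x : ι) : 0 ≤ A.mulVec u x :=
  Finset.sum_nonneg fun y _ => mul_nonneg (hA x y) (hu y)

theorem mulVec_le_mulVec {ι κ : Type*} [Fintype κ] {A : Matrix ι κ ℝ}
    (hA : ∀ x y, 0 ≤ A x y) {u w : κ → ℝ} (h : ∀ y, u y ≤ w y) (x : ι) :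
    A.mulVec u x ≤ A.mulVec w x :=
  Finset.sum_le_sum fun y _ => mul_le_mul_of_nonneg_left (h y) (hA x y)

theorem mulVec_pos_of_pos {κ : Type*} [Fintype κ] {A : Matrix κ κ ℝ}
    (hA : ∀ x y, 0 < A x y) {u : κ → ℝ}
    (hu : ∀ y, 0 ≤ u y) (hu0 : u ≠ 0) (x : κ) : 0 < A.mulVec u x := by
  obtain ⟨y, hy⟩ := Function.ne_iff.1 hu0
  exact Finset.sum_pos' (fun y _ => mul_nonneg (hA x y).le (hu y))
    ⟨y, Finset.mem_univ _, mul_pos (hA x y) (lt_of_le_of_ne (hu y) (Ne.symm hy))⟩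

theorem pow_mulVec_of_mulVec_eq_smul {A : Matrix κ κ ℝ} {μ : ℝ} {v : κ → ℝ}
    (h : A.mulVec v = μ • v) (t : ℕ) : (A ^ t).mulVec v = μ ^ t • v := by
  induction t with
  | zero => simp
  | succ t ih => rw [pow_succ, ← Matrix.mulVec_mulVec, h, Matrix.mulVec_smul, ih, smul_smul,
      pow_succ']

/-- **Perron's theorem**: a primitive matrix has a positive eigenvector. -/
theorem exists_pos_eigenvector [Nonempty κ] {A : Matrix κ κ ℝ} (hA : A.IsPrimitive) :
    ∃ ρ : ℝ, 0 < ρ ∧ ∃ v : κ → ℝ, (∀ x, 0 < v x) ∧ A.mulVec v = ρ • v := by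
  obtain ⟨k, -, hk⟩ := hA.exists_pos_pow
  -- Collatz–Wielandt: `ρ` is the largest `μ` for which some `u` in the simplex satisfies `μ u ≤ A
  -- u`. It is attained because `S` is compact, with `μ` bounded by the sum of all entries.
  set S : Set (ℝ × (κ → ℝ)) :=
    {p | 0 ≤ p.1 ∧ p.2 ∈ stdSimplex ℝ κ ∧ ∀ x, p.1 * p.2 x ≤ A.mulVec p.2 x} with hS
  have hcont : ∀ x, Continuous fun p : ℝ × (κ → ℝ) => A.mulVec p.2 x := fun x => by
    simp only [Matrix.mulVec, dotProduct]
    fun_prop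
  have hScl : IsClosed S := by
    refine (isClosed_le continuous_const continuous_fst).inter
      (((isClosed_stdSimplex ℝ κ).preimage continuous_snd).inter ?_)
    have hInter : {p : ℝ × (κ → ℝ) | ∀ x, p.1 * p.2 x ≤ A.mulVec p.2 x} =
        ⋂ x, {p : ℝ × (κ → ℝ) | p.1 * p.2 x ≤ A.mulVec p.2 x} := by
      ext p
      simp
    have hcl : IsClosed {p : ℝ × (κ → ℝ) | ∀ x, p.1 * p.2 x ≤ A.mulVec p.2 x} := by
      rw [hInter]
      refine isClosed_iInter fun x => isClosed_le ?_ (hcont x)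
      fun_prop
    exact hcl
  have hScp : IsCompact S := by
    refine ((isCompact_Icc (a := (0 : ℝ)) (b := ∑ x, ∑ y, A x y)).prod
      (isCompact_stdSimplex ℝ κ)).of_isClosed_subset hScl ?_
    rintro ⟨μ, u⟩ ⟨h0, h1, h2⟩
    refine ⟨⟨h0, ?_⟩, h1⟩
    calc μ = ∑ x, μ * u x := by rw [← Finset.mul_sum, h1.2, mul_one]
      _ ≤ ∑ x, A.mulVec u x := Finset.sum_le_sum fun x _ => h2 x
      _ ≤ ∑ x, ∑ y, A x y := by
        refine Finset.sum_le_sum fun x _ => Finset.sum_le_sum fun y _ => ?_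
        have hy : u y ≤ 1 := by
          rw [← h1.2]
          exact Finset.single_le_sum (fun z _ => h1.1 z) (Finset.mem_univ y)
        exact mul_le_of_le_one_right (hA.nonneg x y) hy
  have hSne : S.Nonempty := by
    obtain ⟨x⟩ := ‹Nonempty κ›
    refine ⟨(0, Pi.single x 1), le_rfl, single_mem_stdSimplex ℝ x, fun y => ?_⟩
    simpa using mulVec_nonneg_of_nonneg hA.nonneg (single_mem_stdSimplex ℝ x).1 y
  obtain ⟨⟨ρ, v⟩, ⟨hρ0, hv, hle⟩, hmax⟩ := hScp.exists_isMaxOn hSne continuous_fst.continuousOn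
  simp only at hρ0 hv hle
  have hv0 : v ≠ 0 := by
    rintro rfl
    simpa using hv.2
  have hpos := mulVec_pos_of_pos hk hv.1 hv0
  have heq : A.mulVec v = ρ • v := by
    -- If `A v - ρ v` were non-zero, the positive matrix `A ^ k` would make the inequality strict in
    -- every coordinate for `w = A ^ k v`, leaving room for `ρ + ε` and contradicting maximality.
    by_contra hne
    set d := A.mulVec v - ρ • v with hd
    have hd0 : ∀ x, 0 ≤ d x := fun x => by simpa [hd] using hle x
    have hdpos := mulVec_pos_of_pos hk hd0 (sub_ne_zero.2 hne)
    set w := (A ^ k).mulVec v with hw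
    have hAw : A.mulVec w = ρ • w + (A ^ k).mulVec d := by
      rw [hw, hd, Matrix.mulVec_sub, Matrix.mulVec_smul, Matrix.mulVec_mulVec,
        Matrix.mulVec_mulVec, ← pow_succ, ← pow_succ']
      abel
    obtain ⟨x₀, hx₀⟩ := Finite.exists_min fun x => (A ^ k).mulVec d x / w x
    set ε := (A ^ k).mulVec d x₀ / w x₀ with hε
    have hεpos : 0 < ε := div_pos (hdpos _) (hpos _)
    have hsum : 0 < ∑ x, w x := Finset.sum_pos (fun x _ => hpos x) Finset.univ_nonempty
    have hmem : (ρ + ε, (∑ x, w x)⁻¹ • w) ∈ S := by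
      refine ⟨by positivity, ⟨fun x => ?_, ?_⟩, fun x => ?_⟩
      · exact mul_nonneg (inv_nonneg.2 hsum.le) (hpos x).le
      · simp only [Pi.smul_apply, smul_eq_mul, ← Finset.mul_sum]
        exact inv_mul_cancel₀ hsum.ne'
      · simp only [Matrix.mulVec_smul, Pi.smul_apply, smul_eq_mul, hAw, Pi.add_apply]
        have := (le_div_iff₀ (hpos x)).1 (hx₀ x)
        have h3 : (ρ + ε) * w x ≤ ρ * w x + (A ^ k).mulVec d x := by linarith
        calc (ρ + ε) * ((∑ x, w x)⁻¹ * w x) = (∑ x, w x)⁻¹ * ((ρ + ε) * w x) := by ring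
          _ ≤ _ := mul_le_mul_of_nonneg_left h3 (inv_nonneg.2 hsum.le)
    have : ρ + ε ≤ ρ := hmax hmem
    linarith
  have hpv := pow_mulVec_of_mulVec_eq_smul heq k
  have hprod : ∀ x, 0 < ρ ^ k * v x := fun x => by
    have := hpos x
    rw [hpv] at this
    simpa using this
  obtain ⟨x⟩ := ‹Nonempty κ›
  have hvpos : ∀ x, 0 < v x := fun x =>
    lt_of_le_of_ne (hv.1 x) fun h => by simpa [← h] using hprod x
  -- With `ρ = 0` one would have `A v = 0` for a positive `v`, hence `A = 0`, which is not
  -- primitive.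
  refine ⟨ρ, lt_of_le_of_ne hρ0 fun h => ?_, v, hvpos, heq⟩
  have h1 := mulVec_pos_of_pos hk (u := A.mulVec v) (mulVec_nonneg_of_nonneg hA.nonneg hv.1) ?_ x
  · rw [heq, ← h, zero_smul, Matrix.mulVec_zero] at h1
    simp at h1
  · intro h0
    have h2 : (A ^ k).mulVec (A.mulVec v) = A.mulVec ((A ^ k).mulVec v) := by
      rw [Matrix.mulVec_mulVec, Matrix.mulVec_mulVec, ← pow_succ, ← pow_succ']
    have h3 : ∀ y z, A y z = 0 := fun y z => by
      have := congrFun h0 y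
      refine (mul_eq_zero.1 ((Finset.sum_eq_zero_iff_of_nonneg
        fun z _ => mul_nonneg (hA.nonneg y z) (hv.1 z)).1 this z (Finset.mem_univ z))).resolve_right
          (hvpos z).ne'
    obtain ⟨k', hk', hk''⟩ := hA.exists_pos_pow
    have : A = 0 := by ext y z; exact h3 y z
    have h4 := hk'' x x
    rw [this, zero_pow hk'.ne'] at h4
    simp at h4

theorem le_mulVec_le_of_stochastic {κ : Type*} [Fintype κ] {P : Matrix κ κ ℝ} (hP : ∀ x y, 0 ≤ P x y)
    (hP1 : ∀ x, ∑ y, P x y = 1) {f : κ → ℝ} {a c : ℝ} (hf : ∀ x, a ≤ f x ∧ f x ≤ c) (x : κ) :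
    a ≤ P.mulVec f x ∧ P.mulVec f x ≤ c := by
  constructor
  · calc a = ∑ y, P x y * a := by rw [← Finset.sum_mul, hP1, one_mul]
      _ ≤ _ := Finset.sum_le_sum fun y _ => mul_le_mul_of_nonneg_left (hf y).1 (hP x y)
  · calc P.mulVec f x ≤ ∑ y, P x y * c :=
        Finset.sum_le_sum fun y _ => mul_le_mul_of_nonneg_left (hf y).2 (hP x y)
      _ = c := by rw [← Finset.sum_mul, hP1, one_mul]

theorem pow_row_sum_eq_one {P : Matrix κ κ ℝ} (hP1 : ∀ x, ∑ y, P x y = 1) (t : ℕ) (x : κ) :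
    ∑ y, (P ^ t) x y = 1 := by
  have h : P.mulVec 1 = (1 : ℝ) • 1 := by
    ext x; simpa [Matrix.mulVec, dotProduct] using hP1 x
  have := congrFun (pow_mulVec_of_mulVec_eq_smul h t) x
  simpa [Matrix.mulVec, dotProduct] using this

/-- Powers of a primitive stochastic matrix converge to a matrix with constant columns. -/
theorem exists_tendsto_pow_mulVec_of_stochastic [Nonempty κ] {P : Matrix κ κ ℝ}
    (hP : P.IsPrimitive) (hP1 : ∀ x, ∑ y, P x y = 1) (f : κ → ℝ) :
    ∃ c : ℝ, (∀ x, Tendsto (fun t : ℕ => (P ^ t).mulVec f x) atTop (𝓝 c)) ∧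
      ((∀ x, 0 ≤ f x) → f ≠ 0 → 0 < c) := by
  obtain ⟨k, hk0, hk⟩ := hP.exists_pos_pow
  have hPt : ∀ t x y, 0 ≤ (P ^ t) x y := fun t => Matrix.pow_apply_nonneg hP.nonneg t
  have hPt1 := pow_row_sum_eq_one hP1
  have hlater : ∀ {a c : ℝ} {t : ℕ}, (∀ x, a ≤ (P ^ t).mulVec f x ∧ (P ^ t).mulVec f x ≤ c) →
      ∀ s, t ≤ s → ∀ x, a ≤ (P ^ s).mulVec f x ∧ (P ^ s).mulVec f x ≤ c := by
    intro a c t h s hs x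
    obtain ⟨q, rfl⟩ := Nat.exists_eq_add_of_le' hs
    rw [pow_add, ← Matrix.mulVec_mulVec]
    exact le_mulVec_le_of_stochastic (hPt q) (hPt1 q) h x
  -- Doeblin's argument: every entry of `P ^ k` is at least `δ > 0`, so the oscillation of `P ^ t f`
  -- contracts by `1 - δ` every `k` steps.
  obtain ⟨⟨x₁, y₁⟩, hmin⟩ := Finite.exists_min fun p : κ × κ => (P ^ k) p.1 p.2
  set δ := (P ^ k) x₁ y₁ with hδ
  have hδ0 : 0 < δ := hk _ _
  have hδ1 : δ ≤ 1 := by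
    rw [← hPt1 k x₁]
    exact Finset.single_le_sum (fun y _ => hPt k x₁ y) (Finset.mem_univ y₁)
  have hδle : ∀ x y, δ ≤ (P ^ k) x y := fun x y => hmin (x, y)
  obtain ⟨ymin, hymin⟩ := Finite.exists_min f
  obtain ⟨ymax, hymax⟩ := Finite.exists_max f
  obtain ⟨y₀⟩ := ‹Nonempty κ›
  have key : ∀ q : ℕ, ∃ a c : ℝ, c - a ≤ (1 - δ) ^ q * (f ymax - f ymin) ∧
      ∀ t, k * q ≤ t → ∀ x, a ≤ (P ^ t).mulVec f x ∧ (P ^ t).mulVec f x ≤ c := by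
    intro q
    induction q with
    | zero =>
      refine ⟨f ymin, f ymax, by simp, hlater (t := k * 0) fun x => ?_⟩
      simpa using ⟨hymin x, hymax x⟩
    | succ q ih =>
      obtain ⟨a, c, hac, h⟩ := ih
      set g := (P ^ (k * q)).mulVec f with hg
      have hgb := h (k * q) le_rfl
      -- Each average gives weight at least `δ` to the value `g y₀`, so both ends of the interval
      -- move towards it by the fraction `δ`.
      refine ⟨a + δ * (g y₀ - a), c - δ * (c - g y₀), ?_, hlater (t := k * (q + 1)) fun x => ?_⟩
      · have := mul_le_mul_of_nonneg_left hac (sub_nonneg.2 hδ1)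
        rw [pow_succ']
        nlinarith
      · have hx : (P ^ (k * (q + 1))).mulVec f = (P ^ k).mulVec g := by
          rw [hg, Matrix.mulVec_mulVec, ← pow_add]
          congr 2
          ring
        rw [hx]
        have e1 : (P ^ k).mulVec g x - a = ∑ y, (P ^ k) x y * (g y - a) := by
          simp only [mul_sub, Finset.sum_sub_distrib, ← Finset.sum_mul, hPt1, one_mul]
          rfl
        have e2 : c - (P ^ k).mulVec g x = ∑ y, (P ^ k) x y * (c - g y) := by
          simp only [mul_sub, Finset.sum_sub_distrib, ← Finset.sum_mul, hPt1, one_mul]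
          rfl
        have i1 : (P ^ k) x y₀ * (g y₀ - a) ≤ ∑ y, (P ^ k) x y * (g y - a) :=
          Finset.single_le_sum (f := fun y => (P ^ k) x y * (g y - a))
            (fun y _ => mul_nonneg (hPt k x y) (sub_nonneg.2 (hgb y).1)) (Finset.mem_univ y₀)
        have i2 : (P ^ k) x y₀ * (c - g y₀) ≤ ∑ y, (P ^ k) x y * (c - g y) :=
          Finset.single_le_sum (f := fun y => (P ^ k) x y * (c - g y))
            (fun y _ => mul_nonneg (hPt k x y) (sub_nonneg.2 (hgb y).2)) (Finset.mem_univ y₀)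
        have j1 := mul_le_mul_of_nonneg_right (hδle x y₀) (sub_nonneg.2 (hgb y₀).1)
        have j2 := mul_le_mul_of_nonneg_right (hδle x y₀) (sub_nonneg.2 (hgb y₀).2)
        constructor <;> linarith
  have hsmall : Tendsto (fun q : ℕ => (1 - δ) ^ q * (f ymax - f ymin)) atTop (𝓝 0) := by
    have := (tendsto_pow_atTop_nhds_zero_of_lt_one (sub_nonneg.2 hδ1)
      (by linarith : 1 - δ < 1)).mul_const (f ymax - f ymin)
    simpa using this
  have hclose : ∀ ε > 0, ∃ N, ∀ s ≥ N, ∀ t ≥ N, ∀ x y,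
      |(P ^ s).mulVec f x - (P ^ t).mulVec f y| < ε := by
    intro ε hε
    obtain ⟨q, hq⟩ := (hsmall.eventually (gt_mem_nhds hε)).exists
    obtain ⟨a, c, hac, h⟩ := key q
    refine ⟨k * q, fun s hs t ht x y => ?_⟩
    have h1 := h s hs x
    have h2 := h t ht y
    rw [abs_lt]
    constructor <;> linarith [h1.1, h1.2, h2.1, h2.2]
  obtain ⟨c, hc⟩ := cauchySeq_tendsto_of_complete (u := fun t => (P ^ t).mulVec f y₀)
    (Metric.cauchySeq_iff.2 fun ε hε => by
      obtain ⟨N, hN⟩ := hclose ε hε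
      exact ⟨N, fun s hs t ht => hN s hs t ht y₀ y₀⟩)
  have hall : ∀ x, Tendsto (fun t : ℕ => (P ^ t).mulVec f x) atTop (𝓝 c) := by
    intro x
    have h0 : Tendsto (fun t : ℕ => (P ^ t).mulVec f x - (P ^ t).mulVec f y₀) atTop (𝓝 0) := by
      rw [Metric.tendsto_atTop]
      intro ε hε
      obtain ⟨N, hN⟩ := hclose ε hε
      refine ⟨N, fun t ht => ?_⟩
      rw [Real.dist_eq, sub_zero]
      exact hN t ht t ht x y₀
    simpa using h0.add hc
  refine ⟨c, hall, fun hf hf0 => ?_⟩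
  have hpos := mulVec_pos_of_pos hk hf hf0
  obtain ⟨x₂, hx₂⟩ := Finite.exists_min ((P ^ k).mulVec f)
  obtain ⟨x₃, hx₃⟩ := Finite.exists_max ((P ^ k).mulVec f)
  refine (hpos x₂).trans_le (ge_of_tendsto (hall y₀) ?_)
  filter_upwards [eventually_ge_atTop k] with t ht
  exact (hlater (fun x => ⟨hx₂ x, hx₃ x⟩) t ht y₀).1

/-- Powers of a primitive matrix, normalised by the eigenvalue of a positive eigenvector,
converge to that eigenvector. -/
theorem exists_tendsto_inv_pow_smul_pow_mulVec [Nonempty κ] {A : Matrix κ κ ℝ}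
    (hA : A.IsPrimitive) {ρ : ℝ} (hρ : 0 < ρ) {v : κ → ℝ} (hv : ∀ x, 0 < v x)
    (hAv : A.mulVec v = ρ • v) (u : κ → ℝ) :
    ∃ c : ℝ, Tendsto (fun t : ℕ => (ρ ^ t)⁻¹ • (A ^ t).mulVec u) atTop (𝓝 (c • v)) ∧
      ((∀ x, 0 ≤ u x) → u ≠ 0 → 0 < c) := by
  -- Conjugation by the diagonal matrix of `v` and division by `ρ` turn `A` into a stochastic
  -- matrix, still primitive.
  set P : Matrix κ κ ℝ := Matrix.of fun x y => A x y * v y / (ρ * v x) with hPdef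
  have hPpow : ∀ t x y, (P ^ t) x y = (A ^ t) x y * v y / (ρ ^ t * v x) := by
    intro t
    induction t with
    | zero =>
      intro x y
      rcases eq_or_ne x y with rfl | h
      · simp [(hv x).ne']
      · simp [h]
    | succ t ih =>
      intro x y
      rw [pow_succ, Matrix.mul_apply, pow_succ A, Matrix.mul_apply, Finset.sum_mul,
        Finset.sum_div]
      refine Finset.sum_congr rfl fun z _ => ?_
      rw [ih]
      simp only [hPdef, Matrix.of_apply]
      have := (hv x).ne'
      have := (hv z).ne'
      rw [pow_succ ρ]
      field_simp
  have hP : P.IsPrimitive := by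
    refine ⟨fun x y => ?_, ?_⟩
    · exact div_nonneg (mul_nonneg (hA.nonneg x y) (hv y).le) (mul_pos hρ (hv x)).le
    · obtain ⟨k, hk0, hk⟩ := hA.exists_pos_pow
      refine ⟨k, hk0, fun x y => ?_⟩
      rw [hPpow]
      exact div_pos (mul_pos (hk x y) (hv y)) (mul_pos (pow_pos hρ k) (hv x))
  have hP1 : ∀ x, ∑ y, P x y = 1 := fun x => by
    have := congrFun hAv x
    simp only [Matrix.mulVec, dotProduct, Pi.smul_apply, smul_eq_mul] at this
    simp only [hPdef, Matrix.of_apply]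
    rw [← Finset.sum_div, this, div_self (mul_pos hρ (hv x)).ne']
  obtain ⟨c, hc, hcpos⟩ := exists_tendsto_pow_mulVec_of_stochastic hP hP1 fun x => u x / v x
  refine ⟨c, tendsto_pi_nhds.2 fun x => ?_, fun hu hu0 => hcpos (fun x => div_nonneg (hu x) (hv x).le) ?_⟩
  · refine ((hc x).mul_const (v x)).congr fun t => ?_
    simp only [Pi.smul_apply, smul_eq_mul, Matrix.mulVec, dotProduct, Finset.sum_mul,
      Finset.mul_sum, hPpow]
    refine Finset.sum_congr rfl fun y _ => ?_
    have := (hv x).ne'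
    have := (hv y).ne'
    field_simp
  · obtain ⟨x, hx⟩ := Function.ne_iff.1 hu0
    exact Function.ne_iff.2 ⟨x, div_ne_zero hx (hv x).ne'⟩

theorem hasEigenvector_toLin'_iff {A : Matrix κ κ ℝ} {μ : ℝ} {v : κ → ℝ} :
    Module.End.HasEigenvector (Matrix.toLin' A) μ v ↔ A.mulVec v = μ • v ∧ v ≠ 0 := by
  rw [Module.End.hasEigenvector_iff, Module.End.mem_eigenspace_iff, Matrix.toLin'_apply]

/-- The eigenvalue of a positive eigenvector of a primitive matrix is its largest eigenvalue. -/
theorem pfEigenvalue_eq_of_pos_eigenvector [Nonempty κ] {A : Matrix κ κ ℝ}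
    (hA : A.IsPrimitive) {ρ : ℝ} (hρ : 0 < ρ) {v : κ → ℝ} (hv : ∀ x, 0 < v x)
    (hAv : A.mulVec v = ρ • v) : pfEigenvalue A = ρ := by
  refine IsGreatest.csSup_eq ⟨?_, fun μ hμ => ?_⟩
  · refine Module.End.hasEigenvalue_of_hasEigenvector (x := v)
      (hasEigenvector_toLin'_iff.2 ⟨hAv, fun h => ?_⟩)
    obtain ⟨x⟩ := ‹Nonempty κ›
    exact (hv x).ne' (congrFun h x)
  · obtain ⟨w, hw⟩ := Module.End.HasEigenvalue.exists_hasEigenvector hμ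
    obtain ⟨hw, hw0⟩ := hasEigenvector_toLin'_iff.1 hw
    by_contra! hlt
    obtain ⟨x, hx⟩ := Function.ne_iff.1 hw0
    -- The normalised orbit of `w` converges, yet it equals `(μ / ρ) ^ t • w`, which is unbounded
    -- for `μ > ρ`.
    obtain ⟨c, hc, -⟩ := exists_tendsto_inv_pow_smul_pow_mulVec hA hρ hv hAv w
    have h1 := (((tendsto_pi_nhds.1 hc) x).mul_const (w x)⁻¹)
    have h2 : Tendsto (fun t : ℕ => (μ / ρ) ^ t) atTop atTop :=
      tendsto_pow_atTop_atTop_of_one_lt ((one_lt_div hρ).2 hlt)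
    refine not_tendsto_nhds_of_tendsto_atTop h2 _ (h1.congr fun t => ?_)
    rw [pow_mulVec_of_mulVec_eq_smul hw]
    simp only [Pi.smul_apply, smul_eq_mul, div_pow]
    rw [← mul_assoc, mul_assoc, mul_inv_cancel₀ hx, mul_one, div_eq_inv_mul]

/-- Perron-Frobenius data for the diagonal blocks of a primitive Frobenius form. -/
theorem exists_pfEigenvector [Nonempty κ] {A : Matrix κ κ ℝ}
    (hA : A.IsPrimitive ∨ (Fintype.card κ = 1 ∧ A = 0)) :
    ∃ v : κ → ℝ, (∀ x, 0 < v x) ∧ A.mulVec v = pfEigenvalue A • v ∧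
      ((A.IsPrimitive ∧ 0 < pfEigenvalue A ∧
        ∀ u : κ → ℝ, (∀ x, 0 ≤ u x) → u ≠ 0 → ∃ c : ℝ, 0 < c ∧
          Tendsto (fun t : ℕ => (pfEigenvalue A ^ t)⁻¹ • (A ^ t).mulVec u) atTop (𝓝 (c • v))) ∨
      (Subsingleton κ ∧ A = 0 ∧ pfEigenvalue A = 0)) := by
  rcases hA with hA | ⟨h1, h0⟩
  · obtain ⟨ρ, hρ, v, hv, hAv⟩ := exists_pos_eigenvector hA
    have hpf := pfEigenvalue_eq_of_pos_eigenvector hA hρ hv hAv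
    refine ⟨v, hv, by rw [hpf, hAv], Or.inl ⟨hA, by rwa [hpf], fun u hu hu0 => ?_⟩⟩
    obtain ⟨c, hc, hcpos⟩ := exists_tendsto_inv_pow_smul_pow_mulVec hA hρ hv hAv u
    exact ⟨c, hcpos hu hu0, by rwa [hpf]⟩
  · have hpf : pfEigenvalue A = 0 := by
      refine IsGreatest.csSup_eq ⟨?_, fun μ hμ => ?_⟩
      · exact Module.End.hasEigenvalue_of_hasEigenvector (x := 1)
          (hasEigenvector_toLin'_iff.2 ⟨by simp [h0], one_ne_zero⟩)
      · obtain ⟨w, hw⟩ := Module.End.HasEigenvalue.exists_hasEigenvector hμ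
        obtain ⟨hw, hw0⟩ := hasEigenvector_toLin'_iff.1 hw
        rw [h0, Matrix.zero_mulVec] at hw
        exact ((smul_eq_zero.1 hw.symm).resolve_right hw0).le
    refine ⟨1, fun _ => one_pos, by rw [hpf, h0, Matrix.zero_mulVec, zero_smul], Or.inr ⟨?_, h0, hpf⟩⟩
    exact Fintype.card_le_one_iff_subsingleton.1 h1.le

/-- The normalised Perron-Frobenius eigenvector of a diagonal block of a primitive Frobenius
form, its uniqueness, and the growth of the powers of the block. -/
theorem exists_normalized_pfEigenvector [Nonempty κ] {A : Matrix κ κ ℝ}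
    (hA : A.IsPrimitive ∨ (Fintype.card κ = 1 ∧ A = 0)) :
    0 ≤ pfEigenvalue A ∧ ∃ v : κ → ℝ, (∀ x, 0 < v x) ∧ ∑ x, v x = 1 ∧
      A.mulVec v = pfEigenvalue A • v ∧
      (∀ w : κ → ℝ, (∀ x, 0 ≤ w x) → w ≠ 0 → A.mulVec w = pfEigenvalue A • w →
        ∃ c : ℝ, w = c • v) ∧
      (0 < pfEigenvalue A → ∀ u : κ → ℝ, (∀ x, 0 ≤ u x) → u ≠ 0 → ∃ c : ℝ, 0 < c ∧
        Tendsto (fun t : ℕ => (pfEigenvalue A ^ t)⁻¹ • (A ^ t).mulVec u) atTop (𝓝 (c • v))) ∧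
      (∀ u : κ → ℝ, (∀ x, 0 ≤ u x) →
        ∃ K : ℝ, ∀ t x, (A ^ t).mulVec u x ≤ K * pfEigenvalue A ^ t) ∧
      (∀ u : κ → ℝ, (∀ x, 0 ≤ u x) → u ≠ 0 → ∃ s, ∀ x, 0 < (A ^ s).mulVec u x) := by
  have hA0 : ∀ x y, 0 ≤ A x y := by
    rcases hA with hA | ⟨-, h0⟩
    · exact hA.nonneg
    · simp [h0]
  obtain ⟨v, hv, hAv, hcases⟩ := exists_pfEigenvector hA
  have hρ : 0 ≤ pfEigenvalue A := by
    rcases hcases with ⟨-, h, -⟩ | ⟨-, -, h⟩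
    · exact h.le
    · exact h.ge
  have hsum : 0 < ∑ x, v x := Finset.sum_pos (fun x _ => hv x) Finset.univ_nonempty
  have hv' : ∀ x, 0 < ((∑ x, v x)⁻¹ • v) x := fun x => mul_pos (inv_pos.2 hsum) (hv x)
  have hAv' : A.mulVec ((∑ x, v x)⁻¹ • v) = pfEigenvalue A • ((∑ x, v x)⁻¹ • v) := by
    rw [Matrix.mulVec_smul, hAv, smul_comm]
  have hconv : 0 < pfEigenvalue A → ∀ u : κ → ℝ, (∀ x, 0 ≤ u x) → u ≠ 0 → ∃ c : ℝ, 0 < c ∧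
        Tendsto (fun t : ℕ => (pfEigenvalue A ^ t)⁻¹ • (A ^ t).mulVec u) atTop
          (𝓝 (c • ((∑ x, v x)⁻¹ • v))) := by
    intro hpos u hu hu0
    rcases hcases with ⟨-, -, h⟩ | ⟨-, -, h⟩
    · obtain ⟨c, hc, hlim⟩ := h u hu hu0
      refine ⟨c * ∑ x, v x, mul_pos hc hsum, ?_⟩
      rwa [smul_smul, mul_assoc, mul_inv_cancel₀ hsum.ne', mul_one]
    · exact absurd h hpos.ne'
  refine ⟨hρ, (∑ x, v x)⁻¹ • v, hv', ?_, hAv', ?_, hconv, ?_, ?_⟩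
  · simp only [Pi.smul_apply, smul_eq_mul, ← Finset.mul_sum]
    exact inv_mul_cancel₀ hsum.ne'
  · intro w hw hw0 hAw
    -- The normalised orbit of a competing eigenvector is constant, so it equals its limit, a
    -- multiple of the Perron vector; a zero block has a single coordinate.
    rcases hcases with ⟨-, hpos, -⟩ | ⟨hsub, -, -⟩
    · obtain ⟨c, -, hlim⟩ := hconv hpos w hw hw0
      refine ⟨c, tendsto_nhds_unique (tendsto_const_nhds.congr fun t => ?_) hlim⟩
      rw [pow_mulVec_of_mulVec_eq_smul hAw, inv_smul_smul₀ (pow_ne_zero t hpos.ne')]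
    · obtain ⟨x₀⟩ := ‹Nonempty κ›
      refine ⟨w x₀ / ((∑ x, v x)⁻¹ • v) x₀, funext fun x => ?_⟩
      rw [Subsingleton.elim x x₀, Pi.smul_apply, smul_eq_mul, div_mul_cancel₀ _ (hv' x₀).ne']
  · intro u hu
    -- The constant comes from `u ≤ (max u / v) v`, an inequality preserved by the powers of `A`.
    obtain ⟨x₁, hx₁⟩ := Finite.exists_max fun x => u x / v x
    obtain ⟨x₂, hx₂⟩ := Finite.exists_max v
    have hK : 0 ≤ u x₁ / v x₁ := div_nonneg (hu _) (hv _).le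
    refine ⟨u x₁ / v x₁ * v x₂, fun t x => ?_⟩
    have h1 : (A ^ t).mulVec u x ≤ (A ^ t).mulVec ((u x₁ / v x₁) • v) x :=
      mulVec_le_mulVec (Matrix.pow_apply_nonneg hA0 t) (fun y => (div_le_iff₀ (hv y)).1 (hx₁ y)) x
    rw [Matrix.mulVec_smul, pow_mulVec_of_mulVec_eq_smul hAv] at h1
    simp only [Pi.smul_apply, smul_eq_mul] at h1
    calc _ ≤ _ := h1
      _ = u x₁ / v x₁ * v x * pfEigenvalue A ^ t := by ring
      _ ≤ _ := mul_le_mul_of_nonneg_right (mul_le_mul_of_nonneg_left (hx₂ x) hK)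
        (pow_nonneg hρ t)
  · intro u hu hu0
    rcases hcases with ⟨hprim, -, -⟩ | ⟨hsub, -, -⟩
    · obtain ⟨k, -, hk⟩ := hprim.exists_pos_pow
      exact ⟨k, mulVec_pos_of_pos hk hu hu0⟩
    · obtain ⟨y, hy⟩ := Function.ne_iff.1 hu0
      refine ⟨0, fun x => ?_⟩
      rw [pow_zero, Matrix.one_mulVec, Subsingleton.elim x y]
      exact lt_of_le_of_ne (hu y) (Ne.symm hy)

end PerronFrobenius

/-! ### Walks between blocks and the decomposition by exit time. -/

section Blocks

variable {n r : ℕ} {M : Matrix (Fin n) (Fin n) ℝ} {b : Fin n → Fin r}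

theorem exists_pos_of_mulVec_pos {ι κ : Type*} [Fintype κ] {A : Matrix ι κ ℝ}
    (hA : ∀ x y, 0 ≤ A x y) {v : κ → ℝ} (hv : ∀ y, 0 < v y) {x : ι} {y : κ} (h : 0 < A x y) :
    0 < A.mulVec v x :=
  Finset.sum_pos' (fun z _ => mul_nonneg (hA x z) (hv z).le) ⟨y, Finset.mem_univ _, mul_pos h (hv y)⟩

theorem mul_mulVec_le_pow_add_mulVec (hM : ∀ x y, 0 ≤ M x y) (s t : ℕ) {u : Fin n → ℝ}
    (hu : ∀ x, 0 ≤ u x) (x y : Fin n) :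
    (M ^ s) x y * (M ^ t).mulVec u y ≤ (M ^ (s + t)).mulVec u x := by
  rw [pow_add, ← Matrix.mulVec_mulVec]
  exact Finset.single_le_sum (f := fun z => (M ^ s) x z * (M ^ t).mulVec u z)
    (fun z _ => mul_nonneg (Matrix.pow_apply_nonneg hM s x z)
      (mulVec_nonneg_of_nonneg (Matrix.pow_apply_nonneg hM t) hu z)) (Finset.mem_univ y)

theorem pow_apply_pos_trans (hM : ∀ x y, 0 ≤ M x y) {s t : ℕ} {x y z : Fin n}
    (h1 : 0 < (M ^ s) x y) (h2 : 0 < (M ^ t) y z) : 0 < (M ^ (s + t)) x z := by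
  rw [pow_add, Matrix.mul_apply]
  exact Finset.sum_pos' (fun w _ => mul_nonneg (Matrix.pow_apply_nonneg hM s x w)
    (Matrix.pow_apply_nonneg hM t w z)) ⟨y, Finset.mem_univ _, mul_pos h1 h2⟩

theorem IsPrimitiveFrobeniusForm.pow_apply_eq_zero (hF : IsPrimitiveFrobeniusForm M b) (t : ℕ) :
    ∀ x y, b x < b y → (M ^ t) x y = 0 := by
  induction t with
  | zero =>
    intro x y h
    rw [pow_zero, Matrix.one_apply_ne]
    rintro rfl
    exact lt_irrefl _ h
  | succ t ih =>
    intro x y h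
    rw [pow_succ, Matrix.mul_apply]
    refine Finset.sum_eq_zero fun z _ => ?_
    rcases lt_or_ge (b x) (b z) with hz | hz
    · rw [ih x z hz, zero_mul]
    · rw [hF.lowerTriangular z y (hz.trans_lt h), mul_zero]

theorem IsPrimitiveFrobeniusForm.le_of_pow_apply_pos (hF : IsPrimitiveFrobeniusForm M b) {t : ℕ}
    {x y : Fin n} (h : 0 < (M ^ t) x y) : b y ≤ b x := by
  by_contra! hlt
  exact h.ne' (hF.pow_apply_eq_zero t x y hlt)

theorem IsPrimitiveFrobeniusForm.lt_of_dominates (hF : IsPrimitiveFrobeniusForm M b)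
    {i j : Fin r} (h : Dominates M b i j) : i < j := by
  obtain ⟨hne, t, -, x, y, rfl, rfl, hpos⟩ := h
  exact lt_of_le_of_ne (hF.le_of_pow_apply_pos hpos) hne

theorem IsPrimitiveFrobeniusForm.not_mem_dependencyUnion (hF : IsPrimitiveFrobeniusForm M b)
    (i : Fin r) : i ∉ dependencyUnion M b i := fun h => lt_irrefl _ (hF.lt_of_dominates h)

/-- The left side counts only the weighted walks that stay inside the block. -/
theorem toSquareBlock_pow_le (hM : ∀ x y, 0 ≤ M x y) (j : Fin r) (t : ℕ) :
    ∀ x y : {x // b x = j}, (M.toSquareBlock b j ^ t) x y ≤ (M ^ t) x y := by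
  induction t with
  | zero =>
    intro x y
    simp only [pow_zero, Matrix.one_apply, Subtype.ext_iff, le_refl]
  | succ t ih =>
    intro x y
    rw [pow_succ, pow_succ, Matrix.mul_apply, Matrix.mul_apply]
    calc ∑ z, (M.toSquareBlock b j ^ t) x z * M.toSquareBlock b j z y
        ≤ ∑ z : {x // b x = j}, (M ^ t) x z * M z y :=
          Finset.sum_le_sum fun z _ => mul_le_mul_of_nonneg_right (ih x z) (hM z y)
      _ = ∑ z ∈ Finset.univ.filter (fun z => b z = j), (M ^ t) x z * M z y :=
          (Finset.sum_subtype _ (by simp) fun z => (M ^ t) x z * M z y).symm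
      _ ≤ ∑ z, (M ^ t) x z * M z y :=
          Finset.sum_le_sum_of_subset_of_nonneg (Finset.subset_univ _) fun z _ _ =>
            mul_nonneg (Matrix.pow_apply_nonneg hM t x z) (hM z y)

theorem IsPrimitiveFrobeniusForm.nonempty_block (hF : IsPrimitiveFrobeniusForm M b) (j : Fin r) :
    Nonempty {x // b x = j} :=
  let ⟨x, hx⟩ := hF.surjective j
  ⟨⟨x, hx⟩⟩

theorem IsPrimitiveFrobeniusForm.exists_pow_apply_pos (hF : IsPrimitiveFrobeniusForm M b)
    (hM : ∀ x y, 0 ≤ M x y) {x y : Fin n} (h : b x = b y) : ∃ t, 0 < (M ^ t) x y := by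
  rcases hF.diagonal (b y) with hp | ⟨h1, -⟩
  · obtain ⟨k, -, hk⟩ := hp.exists_pos_pow
    exact ⟨k, (hk ⟨x, h⟩ ⟨y, rfl⟩).trans_le (toSquareBlock_pow_le hM _ k _ _)⟩
  · have := Fintype.card_le_one_iff_subsingleton.1 h1.le
    have hxy : x = y := congrArg Subtype.val (Subsingleton.elim
      (⟨x, h⟩ : {z // b z = b y}) ⟨y, rfl⟩)
    exact ⟨0, by simp [hxy]⟩

/-- The normalised column of the block converges to a positive vector. Positivity for all large `t`,
rather than for some `t`, lets one exponent serve several blocks at once. -/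
theorem IsPrimitiveFrobeniusForm.eventually_pow_apply_pos (hF : IsPrimitiveFrobeniusForm M b)
    (hM : ∀ x y, 0 ≤ M x y) {x y : Fin n} (h : b x = b y) (hpos : 0 < blockPF M b (b y)) :
    ∀ᶠ t in atTop, 0 < (M ^ t) x y := by
  have := hF.nonempty_block (b y)
  obtain ⟨-, v, hv, -, -, -, hconv, -, -⟩ := exists_normalized_pfEigenvector (hF.diagonal (b y))
  obtain ⟨c, hc, hlim⟩ := hconv hpos (Pi.single ⟨y, rfl⟩ 1)
    (fun z => by rw [Pi.single_apply]; split_ifs <;> norm_num) (by simp)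
  have h1 := (tendsto_pi_nhds.1 hlim) ⟨x, h⟩
  filter_upwards [h1.eventually (lt_mem_nhds (mul_pos hc (hv _)))] with t ht
  rw [Pi.smul_apply, Matrix.mulVec_single_one, smul_eq_mul, Matrix.col_apply] at ht
  exact (pos_of_mul_pos_right ht (inv_nonneg.2 (pow_nonneg hpos.le t))).trans_le
    (toSquareBlock_pow_le hM _ t _ _)

/-- Two walks meeting in a block need not meet at the same index; they are joined by a walk inside
that block. Triangularity excludes a return to block `i`. -/
theorem IsPrimitiveFrobeniusForm.mem_dependencyUnion_of_pow_apply_pos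
    (hF : IsPrimitiveFrobeniusForm M b)
    (hM : ∀ x y, 0 ≤ M x y) {i : Fin r} {t : ℕ} {x y : Fin n} (h : 0 < (M ^ t) x y)
    (hy : b y ∈ dependencyUnion M b i) : b x ∈ dependencyUnion M b i := by
  have hlt := hF.lt_of_dominates hy
  obtain ⟨hne, s, hs, x', y', hx', rfl, hpos⟩ := hy
  obtain ⟨q, hq⟩ := hF.exists_pow_apply_pos hM hx'.symm
  exact ⟨(hlt.trans_le (hF.le_of_pow_apply_pos h)).ne, t + q + s, by omega, x, y', rfl, rfl,
    pow_apply_pos_trans hM (pow_apply_pos_trans hM h hq) hpos⟩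

theorem IsPrimitiveFrobeniusForm.pow_mulVec_mem_blockCone (hF : IsPrimitiveFrobeniusForm M b)
    (hM : ∀ x y, 0 ≤ M x y) {i : Fin r} (t : ℕ) {u : Fin n → ℝ}
    (hu : u ∈ blockCone b (dependencyUnion M b i)) :
    (M ^ t).mulVec u ∈ blockCone b (dependencyUnion M b i) := by
  refine ⟨mulVec_nonneg_of_nonneg (Matrix.pow_apply_nonneg hM t) hu.1, fun x hx => ?_⟩
  rw [Matrix.mulVec, dotProduct]
  refine Finset.sum_eq_zero fun y _ => ?_
  by_cases hy : b y ∈ dependencyUnion M b i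
  · have : (M ^ t) x y = 0 := by
      by_contra h
      exact hx (hF.mem_dependencyUnion_of_pow_apply_pos hM
        (lt_of_le_of_ne (Matrix.pow_apply_nonneg hM t x y) (Ne.symm h)) hy)
    rw [this, zero_mul]
  · rw [hu.2 y hy, mul_zero]

/-- The inclusion of the coordinates of a block. -/
def blockIncl (b : Fin n → Fin r) (i : Fin r) : Matrix (Fin n) {x // b x = i} ℝ :=
  Matrix.of fun x y => if x = y then 1 else 0

/-- The part of the block column of `M` outside the diagonal block. -/
def blockExit (M : Matrix (Fin n) (Fin n) ℝ) (b : Fin n → Fin r) (i : Fin r) :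
    Matrix (Fin n) {x // b x = i} ℝ :=
  Matrix.of fun x y => if b x = i then 0 else M x y

theorem blockIncl_mulVec (i : Fin r) (v : {x // b x = i} → ℝ) (x : Fin n) :
    (blockIncl b i).mulVec v x = if h : b x = i then v ⟨x, h⟩ else 0 := by
  simp only [Matrix.mulVec, dotProduct, blockIncl, Matrix.of_apply, ite_mul, one_mul, zero_mul]
  split_ifs with h
  · rw [Finset.sum_eq_single ⟨x, h⟩]
    · simp
    · intro y _ hy
      rw [if_neg]
      rintro rfl
      exact hy rfl
    · simp
  · refine Finset.sum_eq_zero fun y _ => if_neg ?_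
    rintro rfl
    exact h y.2

theorem blockIncl_mul_apply {α : Type*} (i : Fin r)
    (A : Matrix {x // b x = i} α ℝ) (x : Fin n) (y : α) :
    (blockIncl b i * A) x y = if h : b x = i then A ⟨x, h⟩ y else 0 :=
  blockIncl_mulVec i (fun z => A z y) x

theorem mul_blockIncl_apply (i : Fin r)
    (A : Matrix (Fin n) (Fin n) ℝ) (x : Fin n) (y : {x // b x = i}) :
    (A * blockIncl b i) x y = A x y := by
  simp [Matrix.mul_apply, blockIncl]

theorem mul_blockIncl (M : Matrix (Fin n) (Fin n) ℝ) (b : Fin n → Fin r) (i : Fin r) :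
    M * blockIncl b i = blockIncl b i * M.toSquareBlock b i + blockExit M b i := by
  ext x y
  rw [mul_blockIncl_apply, Matrix.add_apply, blockIncl_mul_apply]
  by_cases h : b x = i
  · simp [h, blockExit, Matrix.toSquareBlock_def]
  · simp [h, blockExit]

/-- Discrete Duhamel formula: the `s`-th summand is the mass that spends `s` steps in the block,
leaves it at the next step, and moves freely for the remaining `t - 1 - s`. -/
theorem pow_mul_blockIncl (M : Matrix (Fin n) (Fin n) ℝ) (b : Fin n → Fin r) (i : Fin r) (t : ℕ) :
    M ^ t * blockIncl b i = blockIncl b i * M.toSquareBlock b i ^ t +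
      ∑ s ∈ Finset.range t, M ^ (t - 1 - s) * (blockExit M b i * M.toSquareBlock b i ^ s) := by
  induction t with
  | zero => simp
  | succ t ih =>
    rw [pow_succ, Matrix.mul_assoc, mul_blockIncl, Matrix.mul_add, ← Matrix.mul_assoc, ih,
      Matrix.add_mul, Matrix.mul_assoc, ← pow_succ, Finset.sum_range_succ', Matrix.sum_mul,
      add_assoc]
    congr 2
    · refine Finset.sum_congr rfl fun s _ => ?_
      rw [Matrix.mul_assoc, Matrix.mul_assoc, ← pow_succ,
        show t + 1 - 1 - (s + 1) = t - 1 - s by omega]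
    · simp

theorem pow_mulVec_blockIncl (M : Matrix (Fin n) (Fin n) ℝ) (b : Fin n → Fin r) (i : Fin r)
    (t : ℕ) (v : {x // b x = i} → ℝ) (y : Fin n) :
    (M ^ t).mulVec ((blockIncl b i).mulVec v) y =
      (blockIncl b i).mulVec ((M.toSquareBlock b i ^ t).mulVec v) y +
      ∑ x, ∑ s ∈ Finset.range t,
        (blockExit M b i).mulVec ((M.toSquareBlock b i ^ s).mulVec v) x *
          (M ^ (t - 1 - s)) y x := by
  rw [Matrix.mulVec_mulVec, pow_mul_blockIncl, Matrix.add_mulVec, Matrix.mulVec_mulVec,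
    Pi.add_apply, Matrix.sum_mulVec, Finset.sum_apply, Finset.sum_comm]
  congr 1
  refine Finset.sum_congr rfl fun s _ => ?_
  rw [← Matrix.mulVec_mulVec, ← Matrix.mulVec_mulVec]
  simp only [Matrix.mulVec, dotProduct]
  exact Finset.sum_congr rfl fun x _ => mul_comm _ _

theorem blockIncl_mulVec_restrict {i : Fin r} {v : Fin n → ℝ} (hv : v ∈ blockCone b {i}) :
    (blockIncl b i).mulVec (fun x => v x.1) = v := by
  ext x
  rw [blockIncl_mulVec]
  split_ifs with h
  · rfl
  · exact (hv.2 x h).symm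

theorem blockIncl_mulVec_mem_blockCone {i : Fin r} {v : {x // b x = i} → ℝ} (hv : ∀ x, 0 ≤ v x) :
    (blockIncl b i).mulVec v ∈ blockCone b {i} := by
  refine ⟨fun x => ?_, fun x hx => ?_⟩
  · rw [blockIncl_mulVec]
    split_ifs with h
    exacts [hv _, le_rfl]
  · rw [blockIncl_mulVec, dif_neg (by simpa using hx)]

theorem blockExit_nonneg (hM : ∀ x y, 0 ≤ M x y) (i : Fin r) (x : Fin n) (y : {x // b x = i}) :
    0 ≤ blockExit M b i x y := by
  simp only [blockExit, Matrix.of_apply]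
  split_ifs
  exacts [le_rfl, hM _ _]

theorem blockExit_mulVec_mem_blockCone (hM : ∀ x y, 0 ≤ M x y) {i : Fin r}
    {v : {x // b x = i} → ℝ} (hv : ∀ x, 0 ≤ v x) :
    (blockExit M b i).mulVec v ∈ blockCone b (dependencyUnion M b i) := by
  refine ⟨mulVec_nonneg_of_nonneg (blockExit_nonneg hM i) hv, fun x hx => ?_⟩
  rw [Matrix.mulVec, dotProduct]
  refine Finset.sum_eq_zero fun y _ => ?_
  have : blockExit M b i x y = 0 := by
    simp only [blockExit, Matrix.of_apply]
    split_ifs with h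
    · rfl
    · by_contra h0
      refine hx ⟨Ne.symm h, 1, le_rfl, x, y, rfl, y.2, ?_⟩
      rw [pow_one]
      exact lt_of_le_of_ne (hM x y) (Ne.symm h0)
  rw [this, zero_mul]

/-- Mass leaving a block eventually fills all the blocks below it with positive eigenvalue. -/
theorem IsPrimitiveFrobeniusForm.eventually_pow_mulVec_blockExit_pos
    (hF : IsPrimitiveFrobeniusForm M b) (hM : ∀ x y, 0 ≤ M x y) {i : Fin r}
    {v : {x // b x = i} → ℝ} (hv : ∀ x, 0 < v x) {x : Fin n}
    (hx : b x ∈ dependencyUnion M b i) (hpos : 0 < blockPF M b (b x)) :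
    ∀ᶠ t in atTop, 0 < (M ^ t).mulVec ((blockExit M b i).mulVec v) x := by
  obtain ⟨hne, t, -, x', y', hx', hy', htpos⟩ := hx
  have hMR : ∀ (m : ℕ) x y, 0 ≤ (M ^ m * blockExit M b i) x y := fun m x y => by
    rw [Matrix.mul_apply]
    exact Finset.sum_nonneg fun z _ => mul_nonneg (Matrix.pow_apply_nonneg hM m x z)
      (blockExit_nonneg hM i z y)
  -- If no exiting mass ever reached `x'`, the exit decomposition would make `(M ^ t) x' y'` vanish,
  -- against the domination.
  obtain ⟨m, hm⟩ : ∃ m, 0 < (M ^ m).mulVec ((blockExit M b i).mulVec v) x' := by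
    by_contra! hall
    have hzero : ∀ (m : ℕ) y, (M ^ m * blockExit M b i) x' y = 0 := by
      intro m y
      by_contra h0
      have := exists_pos_of_mulVec_pos (hMR m) hv (lt_of_le_of_ne (hMR m x' y) (Ne.symm h0))
      rw [← Matrix.mulVec_mulVec] at this
      exact absurd this (hall m).not_gt
    have h1 := congrFun (congrFun (pow_mul_blockIncl M b i t) x') ⟨y', hy'⟩
    rw [mul_blockIncl_apply, Matrix.add_apply, blockIncl_mul_apply,
      dif_neg (by rw [hx']; exact hne.symm), zero_add, Matrix.sum_apply,
      Finset.sum_eq_zero] at h1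
    · exact htpos.ne' h1
    · intro s _
      rw [← Matrix.mul_assoc, Matrix.mul_apply]
      exact Finset.sum_eq_zero fun z _ => by rw [hzero, zero_mul]
  have hev := hF.eventually_pow_apply_pos hM (x := x) (y := x') hx'.symm (by rwa [hx'])
  obtain ⟨N, hN⟩ := eventually_atTop.1 hev
  filter_upwards [eventually_ge_atTop (N + m)] with p hp
  obtain ⟨q, rfl⟩ := Nat.exists_eq_add_of_le' (le_of_add_le_right hp)
  refine (mul_pos (hN q (by omega)) hm).trans_le (mul_mulVec_le_pow_add_mulVec hM q m ?_ x x')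
  exact mulVec_nonneg_of_nonneg (blockExit_nonneg hM i) fun y => (hv y).le

/-! ### How adding the top block changes the growth type. -/

section Growth

variable {i : Fin r}

theorem finite_image_blockPF (S : Set (Fin r)) : (blockPF M b '' S).Finite := S.toFinite.image _

theorem blockPF_le_maxPF {S : Set (Fin r)} {j : Fin r} (hj : j ∈ S) :
    blockPF M b j ≤ maxPF M b S :=
  le_csSup (finite_image_blockPF S).bddAbove ⟨j, hj, rfl⟩

theorem maxPF_insert {S : Set (Fin r)} (hS : S.Nonempty) :
    maxPF M b (insert i S) = max (blockPF M b i) (maxPF M b S) := by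
  rw [maxPF, Set.image_insert_eq, csSup_insert (finite_image_blockPF S).bddAbove (hS.image _)]
  rfl

theorem bddAbove_topChain_card (S : Set (Fin r)) :
    BddAbove {k : ℕ | ∃ T : Finset (Fin r), IsTopChain M b S T ∧ T.card = k} :=
  ⟨Fintype.card (Fin r), by rintro k ⟨T, -, rfl⟩; exact T.card_le_univ⟩

theorem IsTopChain.card_le_chainLength {S : Set (Fin r)} {T : Finset (Fin r)}
    (hT : IsTopChain M b S T) : T.card ≤ chainLength M b S :=
  le_csSup (bddAbove_topChain_card S) ⟨T, hT, rfl⟩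

theorem exists_isTopChain_card_eq (S : Set (Fin r)) :
    ∃ T : Finset (Fin r), IsTopChain M b S T ∧ T.card = chainLength M b S :=
  Nat.sSup_mem (s := {k : ℕ | ∃ T : Finset (Fin r), IsTopChain M b S T ∧ T.card = k})
    ⟨0, ∅, ⟨by simp, by simp, by simp⟩, rfl⟩ (bddAbove_topChain_card S)

theorem isTopChain_singleton {S : Set (Fin r)} {j : Fin r} (hj : j ∈ S)
    (h : blockPF M b j = maxPF M b S) : IsTopChain M b S {j} :=
  ⟨by simpa using hj, by simp, by simpa using h⟩

theorem one_le_chainLength {S : Set (Fin r)} (hS : S.Nonempty) : 1 ≤ chainLength M b S := by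
  obtain ⟨j, hj, h⟩ := (hS.image (blockPF M b)).csSup_mem (finite_image_blockPF S)
  exact (isTopChain_singleton hj h).card_le_chainLength

theorem chainLength_insert_of_gt {S : Set (Fin r)} (hS : S.Nonempty)
    (h : maxPF M b S < blockPF M b i) : chainLength M b (insert i S) = 1 := by
  refine le_antisymm ?_ (one_le_chainLength (Set.insert_nonempty i S))
  obtain ⟨T, ⟨hTS, -, hT⟩, hc⟩ := exists_isTopChain_card_eq (M := M) (b := b) (insert i S)
  rw [← hc, ← Finset.card_singleton i]
  refine Finset.card_le_card fun j hj => ?_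
  rcases hTS hj with rfl | hjS
  · simp
  · have h1 := hT j hj
    rw [maxPF_insert hS, max_eq_left h.le] at h1
    exact absurd (blockPF_le_maxPF (M := M) (b := b) hjS) (by rw [h1]; exact h.not_ge)

/-- Block `i` dominates everything in its dependency union, so it extends every top chain there;
conversely, erasing it shortens a chain by at most one. -/
theorem chainLength_insert_of_eq (hi : i ∉ dependencyUnion M b i)
    (hS : (dependencyUnion M b i).Nonempty)
    (h : blockPF M b i = maxPF M b (dependencyUnion M b i)) :
    chainLength M b (insert i (dependencyUnion M b i)) =
      chainLength M b (dependencyUnion M b i) + 1 := by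
  have hmax : maxPF M b (insert i (dependencyUnion M b i)) = maxPF M b (dependencyUnion M b i) := by
    rw [maxPF_insert hS, h, max_self]
  refine le_antisymm ?_ ?_
  · obtain ⟨T, ⟨hTS, hch, hT⟩, hc⟩ :=
      exists_isTopChain_card_eq (M := M) (b := b) (insert i (dependencyUnion M b i))
    have h1 : IsTopChain M b (dependencyUnion M b i) (T.erase i) := by
      refine ⟨fun j hj => ?_, hch.mono ?_, fun j hj => ?_⟩
      · have hj' := Finset.mem_erase.1 (Finset.mem_coe.1 hj)
        exact (hTS hj'.2).resolve_left hj'.1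
      · exact Finset.coe_subset.2 (Finset.erase_subset i T)
      · rw [hT j (Finset.mem_of_mem_erase hj), hmax]
    have h2 := h1.card_le_chainLength
    have h3 := Finset.pred_card_le_card_erase (s := T) (a := i)
    omega
  · obtain ⟨T, ⟨hTS, hch, hT⟩, hc⟩ :=
      exists_isTopChain_card_eq (M := M) (b := b) (dependencyUnion M b i)
    have hiT : i ∉ T := fun h => hi (hTS h)
    rw [← hc, ← Finset.card_insert_of_notMem hiT]
    refine IsTopChain.card_le_chainLength ⟨?_, ?_, fun j hj => ?_⟩
    · rw [Finset.coe_insert]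
      exact Set.insert_subset_insert hTS
    · rw [Finset.coe_insert]
      exact hch.insert fun j hj _ => Or.inl (hTS hj)
    · rw [hmax]
      rcases Finset.mem_insert.1 hj with rfl | hj
      exacts [h, hT j hj]

/-- A block of smaller eigenvalue belongs to no top chain. -/
theorem chainLength_insert_of_lt {S : Set (Fin r)} (hS : S.Nonempty)
    (h : blockPF M b i < maxPF M b S) : chainLength M b (insert i S) = chainLength M b S := by
  have hmax : maxPF M b (insert i S) = maxPF M b S := by
    rw [maxPF_insert hS, max_eq_right h.le]
  have : ∀ T, IsTopChain M b (insert i S) T ↔ IsTopChain M b S T := by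
    intro T
    constructor
    · rintro ⟨hTS, hch, hT⟩
      refine ⟨fun j hj => (hTS hj).resolve_left ?_, hch, fun j hj => hmax ▸ hT j hj⟩
      rintro rfl
      exact h.ne (hmax ▸ hT j hj)
    · rintro ⟨hTS, hch, hT⟩
      exact ⟨hTS.trans (Set.subset_insert i S), hch, fun j hj => hmax.symm ▸ hT j hj⟩
  simp only [chainLength, this]

end Growth

end Blocks

/-! ### Limits of normalised orbits in the three cases. -/

section Limits

variable {n r : ℕ} {M : Matrix (Fin n) (Fin n) ℝ} {b : Fin n → Fin r} {i : Fin r}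

/-- The exponent `s + 1` accounts for the step on which mass leaves the block: `(s + 1) + (t - 1 -
s) = t`. -/
theorem sum_convolution_eq_pow_mul {f g : ℕ → ℝ} {μ : ℝ} (hμ : μ ≠ 0) (t : ℕ) :
    ∑ s ∈ Finset.range t, f s * g (t - 1 - s) =
      μ ^ t * ∑ s ∈ Finset.range t, f s / μ ^ (s + 1) * (g (t - 1 - s) / μ ^ (t - 1 - s)) := by
  rw [Finset.mul_sum]
  refine Finset.sum_congr rfl fun s hs => ?_
  have hst : t = s + 1 + (t - 1 - s) := by have := Finset.mem_range.1 hs; omega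
  have h : μ ^ t = μ ^ (s + 1) * μ ^ (t - 1 - s) := by rw [← pow_add, ← hst]
  rw [h]
  have h1 := pow_ne_zero (s + 1) hμ
  have h2 := pow_ne_zero (t - 1 - s) hμ
  field_simp

/-- `W` collects the limits of the normalised columns of the powers of `M` in the blocks
of `S`. -/
def IsColumnLimit (M : Matrix (Fin n) (Fin n) ℝ) (b : Fin n → Fin r) (S : Set (Fin r))
    (W : Fin n → Fin n → ℝ) : Prop :=
  ∀ x, b x ∈ S → ∀ y, Tendsto
    (fun m : ℕ => (M ^ m) y x / maxPF M b S ^ m / (m : ℝ) ^ (chainLength M b S - 1)) atTop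
    (𝓝 (W x y))

theorem ConvergenceCondition.exists_isColumnLimit {S : Set (Fin r)}
    (h : ConvergenceCondition M b S) : ∃ W, IsColumnLimit M b S W := by
  have key : ∀ x, ∃ w : Fin n → ℝ, b x ∈ S → ∀ y, Tendsto
      (fun m : ℕ => (M ^ m) y x / maxPF M b S ^ m / (m : ℝ) ^ (chainLength M b S - 1)) atTop
      (𝓝 (w y)) := by
    intro x
    by_cases hx : b x ∈ S
    · obtain ⟨w, hw, -⟩ := h.2 (Pi.single x 1) ⟨fun z => by
        rw [Pi.single_apply]; split_ifs <;> norm_num, fun z hz => by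
        rw [Pi.single_apply, if_neg]; rintro rfl; exact hz hx⟩
      refine ⟨w, fun _ y => ((tendsto_pi_nhds.1 hw) y).congr fun m => ?_⟩
      rw [Pi.smul_apply, Matrix.mulVec_single_one, smul_eq_mul, Matrix.col_apply, growthFun,
        div_div, div_eq_inv_mul]
    · exact ⟨0, fun h => absurd h hx⟩
  choose W hW using key
  exact ⟨W, hW⟩

theorem IsColumnLimit.tendsto {S : Set (Fin r)} {W : Fin n → Fin n → ℝ}
    (hW : IsColumnLimit M b S W) {u : Fin n → ℝ} (hu : u ∈ blockCone b S) :
    Tendsto (fun t : ℕ => (growthFun M b S t)⁻¹ • (M ^ t).mulVec u) atTop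
      (𝓝 (∑ x, u x • W x)) := by
  refine tendsto_pi_nhds.2 fun y => ?_
  have h : Tendsto (fun t : ℕ => ∑ x, u x *
      ((M ^ t) y x / maxPF M b S ^ t / (t : ℝ) ^ (chainLength M b S - 1))) atTop
      (𝓝 (∑ x, u x * W x y)) := by
    refine tendsto_finsetSum _ fun x _ => ?_
    by_cases hx : b x ∈ S
    · exact (hW x hx y).const_mul (u x)
    · simp only [hu.2 x hx, zero_mul]
      exact tendsto_const_nhds
  simp only [Finset.sum_apply, Pi.smul_apply, smul_eq_mul]
  refine h.congr fun t => ?_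
  rw [Matrix.mulVec, dotProduct, Finset.mul_sum]
  refine Finset.sum_congr rfl fun x _ => ?_
  rw [growthFun, div_div, div_eq_inv_mul]
  ring

/-- Shifting time by `p` costs only the factor `maxPF ^ p`, so passing from `z` to `M ^ p z` does
not affect whether the limit vanishes. -/
theorem tendsto_growthFun_ratio {S : Set (Fin r)} (hS : 0 < maxPF M b S) (p : ℕ) :
    Tendsto (fun m : ℕ => (growthFun M b S m)⁻¹ * growthFun M b S (m + p)) atTop
      (𝓝 (maxPF M b S ^ p)) := by
  have h1 : Tendsto (fun m : ℕ => ((m : ℝ) + p) / m) atTop (𝓝 1) := by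
    have := (tendsto_natCast_div_add_atTop (p : ℝ)).inv₀ one_ne_zero
    simpa using this
  have h2 := (h1.pow (chainLength M b S - 1)).const_mul (maxPF M b S ^ p)
  rw [one_pow, mul_one] at h2
  refine h2.congr' ?_
  filter_upwards [eventually_gt_atTop 0] with m hm
  have hm' : (m : ℝ) ≠ 0 := by exact_mod_cast hm.ne'
  simp only [growthFun, Nat.cast_add, div_pow, pow_add]
  have := hS.ne'
  field_simp

theorem growthFun_pos {S : Set (Fin r)} (hS : 0 < maxPF M b S) {t : ℕ} (ht : 0 < t) :
    0 < growthFun M b S t := by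
  have : (0 : ℝ) < t := by exact_mod_cast ht
  unfold growthFun
  positivity

/-- Under the convergence condition for the dependency block union, vectors of its cone that
dominate the mass leaving the block have non-zero limits. -/
theorem ConvergenceCondition.columnLimit_isEigenvector
    (hCC : ConvergenceCondition M b (dependencyUnion M b i))
    (hF : IsPrimitiveFrobeniusForm M b) (hM : ∀ x y, 0 ≤ M x y)
    {W : Fin n → Fin n → ℝ} (hW : IsColumnLimit M b (dependencyUnion M b i) W)
    {z : Fin n → ℝ} (hz : z ∈ blockCone b (dependencyUnion M b i))
    {v : {x // b x = i} → ℝ} (hv : ∀ x, 0 < v x) {ε : ℝ} (hε : 0 < ε)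
    (hle : ∀ x, ε * (blockExit M b i).mulVec v x ≤ z x) :
    (∑ x, z x • W x) ∈ blockCone b (dependencyUnion M b i) ∧ IsEigenvector M (∑ x, z x • W x) := by
  set S := dependencyUnion M b i with hS
  have hμ : 0 < maxPF M b S := one_pos.trans_le hCC.1
  obtain ⟨w, hw, hw', -⟩ := hCC.2 z hz
  have hww := tendsto_nhds_unique hw (hW.tendsto hz)
  rw [← hww]
  refine hw'.resolve_right fun hw0 => ?_
  obtain ⟨T, hT, hTc⟩ := exists_isTopChain_card_eq (M := M) (b := b) S
  -- All blocks of the top chain have positive eigenvalue, so a common power `p` makes the orbit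
  -- non-zero on all of them, placing `M ^ p z` in the dominant interior.
  have hev : ∀ᶠ p : ℕ in atTop, ∀ x, b x ∈ T → (M ^ p).mulVec z x ≠ 0 := by
    refine eventually_all.2 fun x => ?_
    by_cases hx : b x ∈ T
    · have hpos : 0 < blockPF M b (b x) := by rw [hT.2.2 _ hx]; exact hμ
      filter_upwards [hF.eventually_pow_mulVec_blockExit_pos hM hv (hT.1 hx) hpos] with p hp _
      have h1 : (M ^ p).mulVec (ε • (blockExit M b i).mulVec v) x ≤ (M ^ p).mulVec z x :=
        mulVec_le_mulVec (Matrix.pow_apply_nonneg hM p) hle x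
      rw [Matrix.mulVec_smul, Pi.smul_apply, smul_eq_mul] at h1
      exact ((mul_pos hε hp).trans_le h1).ne'
    · exact Eventually.of_forall fun p h => absurd h hx
  obtain ⟨p, hp⟩ := hev.exists
  have hmem := hF.pow_mulVec_mem_blockCone hM p hz
  obtain ⟨w', hlim, -, hne⟩ := hCC.2 _ hmem
  refine hne ⟨hmem, T, hT, hTc, hp⟩ (tendsto_nhds_unique hlim ?_)
  have h2 := (tendsto_growthFun_ratio hμ p).smul ((tendsto_add_atTop_iff_nat p).2 hw)
  rw [hw0, smul_zero] at h2
  refine h2.congr' ?_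
  filter_upwards [eventually_gt_atTop 0] with m hm
  have hne' := (growthFun_pos hμ (show 0 < m + p by omega)).ne'
  rw [smul_smul, mul_assoc, mul_inv_cancel₀ hne', mul_one, Matrix.mulVec_mulVec, ← pow_add]

theorem tendsto_blockIncl_orbit {μ e : ℝ} {J : ℕ} {v : {x // b x = i} → ℝ} {y : Fin n}
    {L : Fin n → ℝ}
    (he : Tendsto (fun t : ℕ => (blockIncl b i).mulVec ((M.toSquareBlock b i ^ t).mulVec v) y /
      (μ ^ t * (t : ℝ) ^ J)) atTop (𝓝 e))
    (hL : ∀ x, Tendsto (fun t : ℕ => (∑ s ∈ Finset.range t,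
        (blockExit M b i).mulVec ((M.toSquareBlock b i ^ s).mulVec v) x *
          (M ^ (t - 1 - s)) y x) / (μ ^ t * (t : ℝ) ^ J)) atTop (𝓝 (L x))) :
    Tendsto (fun t : ℕ => ((μ ^ t * (t : ℝ) ^ J)⁻¹ •
      (M ^ t).mulVec ((blockIncl b i).mulVec v)) y) atTop (𝓝 (e + ∑ x, L x)) := by
  refine (he.add (tendsto_finsetSum _ fun x _ => hL x)).congr fun t => ?_
  rw [Pi.smul_apply, pow_mulVec_blockIncl, smul_eq_mul, ← Finset.sum_div, ← add_div,
    div_eq_inv_mul]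

theorem blockExit_mulVec_eq_zero (hM : ∀ x y, 0 ≤ M x y) {v : {x // b x = i} → ℝ}
    (hv : ∀ x, 0 ≤ v x) {x : Fin n} (hx : b x ∉ dependencyUnion M b i) :
    (blockExit M b i).mulVec v x = 0 := (blockExit_mulVec_mem_blockCone hM hv).2 x hx

theorem toSquareBlock_pow_mulVec_nonneg (hM : ∀ x y, 0 ≤ M x y) {v : {x // b x = i} → ℝ}
    (hv : ∀ x, 0 ≤ v x) (s : ℕ) (x : {x // b x = i}) :
    0 ≤ (M.toSquareBlock b i ^ s).mulVec v x :=
  mulVec_nonneg_of_nonneg (Matrix.pow_apply_nonneg (fun _ _ => hM _ _) s) hv x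

theorem tendsto_mulVec {ι κ : Type*} [Fintype κ] {A : Matrix ι κ ℝ}
    {u : ℕ → κ → ℝ} {w : κ → ℝ} (h : Tendsto u atTop (𝓝 w)) :
    Tendsto (fun t => A.mulVec (u t)) atTop (𝓝 (A.mulVec w)) :=
  tendsto_pi_nhds.2 fun x => tendsto_finsetSum _ fun y _ =>
    ((tendsto_pi_nhds.1 h) y).const_mul (A x y)

/-- Column entries are `O(μ^m (m+1)^j)` with `μ < lam`, so comparison with a polynomial times a
geometric series applies. -/
theorem IsColumnLimit.summable {S : Set (Fin r)} {W : Fin n → Fin n → ℝ}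
    (hW : IsColumnLimit M b S W) (hμ : 0 < maxPF M b S) {lam : ℝ} (hlam : maxPF M b S < lam)
    {x : Fin n} (hx : b x ∈ S) (y : Fin n) : Summable fun m : ℕ => (M ^ m) y x / lam ^ m := by
  obtain ⟨K, hK⟩ := exists_abs_le_mul_add_one_pow (hW x hx y)
  have hlam0 := hμ.trans hlam
  set q := maxPF M b S / lam with hq
  have hq0 : 0 < q := div_pos hμ hlam0
  have hq1 : ‖q‖ < 1 := by
    rw [Real.norm_eq_abs, abs_of_pos hq0]
    exact (div_lt_one hlam0).2 hlam
  have hsum : Summable fun m : ℕ =>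
      K * q⁻¹ * (((m + 1 : ℕ) : ℝ) ^ (chainLength M b S - 1) * q ^ (m + 1)) :=
    ((summable_nat_add_iff (f := fun m : ℕ => (m : ℝ) ^ (chainLength M b S - 1) * q ^ m) 1).2
      (summable_pow_mul_geometric_of_norm_lt_one _ hq1)).mul_left _
  refine Summable.of_norm_bounded hsum fun m => ?_
  have h := hK m
  have hμm := pow_pos hμ m
  rw [abs_div, abs_of_pos hμm, div_le_iff₀ hμm] at h
  rw [Real.norm_eq_abs, abs_div, abs_of_pos (pow_pos hlam0 m), div_le_iff₀ (pow_pos hlam0 m)]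
  refine h.trans_eq ?_
  have h3 : q ^ m * lam ^ m = maxPF M b S ^ m := by
    rw [← mul_pow, hq, div_mul_cancel₀ _ hlam0.ne']
  rw [← h3]
  push_cast
  rw [pow_succ q]
  field_simp

theorem isEigenvector_of_tendsto {lam : ℝ} (hlam : lam ≠ 0) {u w : Fin n → ℝ}
    (h : Tendsto (fun t : ℕ => (lam ^ t)⁻¹ • (M ^ t).mulVec u) atTop (𝓝 w)) :
    M.mulVec w = lam • w := by
  refine tendsto_nhds_unique (tendsto_mulVec h)
    ((((tendsto_add_atTop_iff_nat 1).2 h).const_smul lam).congr fun t => ?_)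
  rw [Matrix.mulVec_smul, Matrix.mulVec_mulVec, ← pow_succ', smul_smul]
  congr 1
  rw [pow_succ']
  field_simp

/-- The limits when the block has larger eigenvalue than the blocks below it. -/
theorem exists_limit_of_maxPF_lt (hF : IsPrimitiveFrobeniusForm M b) (hM : ∀ x y, 0 ≤ M x y)
    (hne : (dependencyUnion M b i).Nonempty)
    (hCC : ConvergenceCondition M b (dependencyUnion M b i))
    (hlt : maxPF M b (dependencyUnion M b i) < blockPF M b i)
    {v : {x // b x = i} → ℝ} (hv : ∀ x, 0 < v x)
    (hconv : ∀ u : {x // b x = i} → ℝ, (∀ x, 0 ≤ u x) → u ≠ 0 → ∃ c : ℝ, 0 < c ∧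
      Tendsto (fun t : ℕ => (blockPF M b i ^ t)⁻¹ • (M.toSquareBlock b i ^ t).mulVec u) atTop
        (𝓝 (c • v))) :
    ∃ w₀ ∈ blockCone b (dependencyUnion M b i),
      IsEigenvector M ((blockIncl b i).mulVec v + w₀) ∧
      ∀ u : {x // b x = i} → ℝ, (∀ x, 0 ≤ u x) → u ≠ 0 → ∃ c : ℝ, 0 < c ∧
        Tendsto (fun t : ℕ => (blockGrowthFun M b i t)⁻¹ •
          (M ^ t).mulVec ((blockIncl b i).mulVec u)) atTop
          (𝓝 (c • ((blockIncl b i).mulVec v + w₀))) := by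
  obtain ⟨W, hW⟩ := hCC.exists_isColumnLimit
  set S := dependencyUnion M b i with hS
  set lam := blockPF M b i with hlamdef
  have hμ : 0 < maxPF M b S := one_pos.trans_le hCC.1
  have hlam : 0 < lam := hμ.trans hlt
  have hMt := Matrix.pow_apply_nonneg hM
  -- Formally the resolvent `(lam - M)⁻¹ R v`, expanded as a Neumann series. For `x` outside `S`
  -- summability is not known, but the factor coming from `R v` is zero.
  set w₀ : Fin n → ℝ := fun y =>
    ∑ x, (∑' m : ℕ, (M ^ m) y x / lam ^ m) * ((blockExit M b i).mulVec v x / lam) with hw₀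
  have hlim : ∀ u : {x // b x = i} → ℝ, (∀ x, 0 ≤ u x) → u ≠ 0 → ∃ c : ℝ, 0 < c ∧
      Tendsto (fun t : ℕ => (lam ^ t * (t : ℝ) ^ 0)⁻¹ •
        (M ^ t).mulVec ((blockIncl b i).mulVec u)) atTop
        (𝓝 (c • ((blockIncl b i).mulVec v + w₀))) := by
    intro u hu hu0
    obtain ⟨c, hc, hcu⟩ := hconv u hu hu0
    refine ⟨c, hc, tendsto_pi_nhds.2 fun y => ?_⟩
    have he : Tendsto (fun t : ℕ =>
        (blockIncl b i).mulVec ((M.toSquareBlock b i ^ t).mulVec u) y /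
          (lam ^ t * (t : ℝ) ^ 0)) atTop (𝓝 (c * (blockIncl b i).mulVec v y)) := by
      have := (tendsto_pi_nhds.1 (tendsto_mulVec (A := blockIncl b i) hcu)) y
      simp only [Matrix.mulVec_smul, Pi.smul_apply, smul_eq_mul] at this
      refine this.congr fun t => ?_
      rw [pow_zero, mul_one, div_eq_inv_mul]
    have key := tendsto_blockIncl_orbit (μ := lam) (J := 0) (y := y)
      (L := fun x => c * ((∑' m : ℕ, (M ^ m) y x / lam ^ m) *
        ((blockExit M b i).mulVec v x / lam))) he ?_
    · convert key using 2
      simp only [Pi.smul_apply, Pi.add_apply, smul_eq_mul, mul_add, hw₀, Finset.mul_sum]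
    · intro x
      by_cases hx : b x ∈ S
      · have hG : Tendsto (fun s : ℕ =>
            (blockExit M b i).mulVec ((M.toSquareBlock b i ^ s).mulVec u) x / lam ^ (s + 1) /
              (s : ℝ) ^ 0) atTop (𝓝 (c * ((blockExit M b i).mulVec v x / lam))) := by
          have := ((tendsto_pi_nhds.1 (tendsto_mulVec (A := blockExit M b i) hcu)) x).div_const lam
          simp only [Matrix.mulVec_smul, Pi.smul_apply, smul_eq_mul] at this
          rw [mul_div_assoc] at this
          refine this.congr fun t => ?_
          rw [pow_zero, div_one, pow_succ, ← div_div, div_eq_inv_mul _ (lam ^ t)]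
        have h1 := tendsto_convolution_of_summable (hW.summable hμ hlt hx y) hG
        rw [mul_left_comm] at h1
        refine h1.congr fun t => ?_
        rw [sum_convolution_eq_pow_mul hlam.ne' (g := fun m => (M ^ m) y x),
          mul_div_mul_left _ _ (pow_ne_zero t hlam.ne')]
        congr 1
        -- Here the summable factor is the column sequence and the convergent one is the exit
        -- sequence, so the convolution is read backwards.
        rw [← Finset.sum_range_reflect]
        refine Finset.sum_congr rfl fun s hs => ?_
        have : t - 1 - (t - 1 - s) = s := by have := Finset.mem_range.1 hs; omega
        rw [this, mul_comm]
      · have h0 : ∀ s, (blockExit M b i).mulVec ((M.toSquareBlock b i ^ s).mulVec u) x = 0 :=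
          fun s => blockExit_mulVec_eq_zero hM (toSquareBlock_pow_mulVec_nonneg hM hu s) hx
        rw [blockExit_mulVec_eq_zero hM (fun x => (hv x).le) hx]
        simp only [h0, zero_mul, Finset.sum_const_zero, zero_div, mul_zero]
        exact tendsto_const_nhds
  have hcone : w₀ ∈ blockCone b S := by
    refine ⟨fun y => Finset.sum_nonneg fun x _ => mul_nonneg (tsum_nonneg fun m =>
      div_nonneg (hMt m y x) (pow_pos hlam m).le) (div_nonneg
        ((blockExit_mulVec_mem_blockCone hM fun x => (hv x).le).1 x) hlam.le), fun y hy => ?_⟩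
    refine Finset.sum_eq_zero fun x _ => ?_
    by_cases hx : b x ∈ S
    · have h0 : ∀ m : ℕ, (M ^ m) y x / lam ^ m = 0 := by
        intro m
        by_contra h
        refine hy (hF.mem_dependencyUnion_of_pow_apply_pos hM (lt_of_le_of_ne (hMt m y x) ?_) hx)
        exact fun h0 => h (by rw [← h0, zero_div])
      simp only [h0, tsum_zero, zero_mul]
    · rw [blockExit_mulVec_eq_zero hM (fun x => (hv x).le) hx, zero_div, mul_zero]
  refine ⟨w₀, hcone, ?_, ?_⟩
  · obtain ⟨x₀⟩ := hF.nonempty_block i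
    have hv0 : v ≠ 0 := fun h => (hv x₀).ne' (congrFun h x₀)
    -- A limit of `lam^(-t) M^t` applied to a fixed vector satisfies the eigenvector equation for
    -- `lam`. It is non-zero because in block `i`, where `w₀` vanishes, it is a positive multiple of
    -- `v`.
    obtain ⟨c, hc, hcv⟩ := hlim v (fun x => (hv x).le) hv0
    simp only [pow_zero, mul_one] at hcv
    have h1 := isEigenvector_of_tendsto hlam.ne' hcv
    rw [Matrix.mulVec_smul, smul_comm] at h1
    refine ⟨lam, hasEigenvector_toLin'_iff.2 ⟨smul_right_injective _ hc.ne' h1, fun h => ?_⟩⟩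
    have h2 := congrFun h x₀
    rw [Pi.add_apply, blockIncl_mulVec, dif_pos x₀.2, hcone.2 x₀
      (by rw [x₀.2]; exact hF.not_mem_dependencyUnion i), add_zero] at h2
    exact (hv x₀).ne' h2
  · intro u hu hu0
    obtain ⟨c, hc, hcu⟩ := hlim u hu hu0
    refine ⟨c, hc, ?_⟩
    have hins : maxPF M b (insert i S) = lam := by
      rw [maxPF_insert hne]
      exact max_eq_left hlt.le
    simp only [blockGrowthFun, growthFun, ← hS, chainLength_insert_of_gt hne hlt, hins]
    exact hcu

/-- The limits when the block has the maximal eigenvalue of the blocks below it. -/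
theorem exists_limit_of_eq_maxPF (hF : IsPrimitiveFrobeniusForm M b) (hM : ∀ x y, 0 ≤ M x y)
    (hne : (dependencyUnion M b i).Nonempty)
    (hCC : ConvergenceCondition M b (dependencyUnion M b i))
    (heq : blockPF M b i = maxPF M b (dependencyUnion M b i))
    {v : {x // b x = i} → ℝ} (hv : ∀ x, 0 < v x)
    (hconv : ∀ u : {x // b x = i} → ℝ, (∀ x, 0 ≤ u x) → u ≠ 0 → ∃ c : ℝ, 0 < c ∧
      Tendsto (fun t : ℕ => (blockPF M b i ^ t)⁻¹ • (M.toSquareBlock b i ^ t).mulVec u) atTop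
        (𝓝 (c • v))) :
    ∃ w ∈ blockCone b (dependencyUnion M b i), IsEigenvector M w ∧
      ∀ u : {x // b x = i} → ℝ, (∀ x, 0 ≤ u x) → u ≠ 0 → ∃ c : ℝ, 0 < c ∧
        Tendsto (fun t : ℕ => (blockGrowthFun M b i t)⁻¹ •
          (M ^ t).mulVec ((blockIncl b i).mulVec u)) atTop (𝓝 (c • w)) := by
  obtain ⟨W, hW⟩ := hCC.exists_isColumnLimit
  obtain ⟨hwc, hwe⟩ := hCC.columnLimit_isEigenvector hF hM hW
    (blockExit_mulVec_mem_blockCone hM fun x => (hv x).le) hv one_pos fun x => by rw [one_mul]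
  refine ⟨_, hwc, hwe, fun u hu hu0 => ?_⟩
  obtain ⟨c, hc, hcu⟩ := hconv u hu hu0
  set S := dependencyUnion M b i with hS
  set lam := blockPF M b i with hlamdef
  set j := chainLength M b S - 1 with hj
  have hlam : 0 < lam := heq ▸ one_pos.trans_le hCC.1
  -- The factor `lam` pays for the exit step, and `j + 1` comes from summing `m ^ j`.
  refine ⟨c / (lam * ((j : ℝ) + 1)), by positivity, ?_⟩
  have hJ : chainLength M b (insert i S) - 1 = j + 1 := by
    have := one_le_chainLength (M := M) (b := b) hne
    have h1 : chainLength M b (insert i S) = chainLength M b S + 1 :=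
      chainLength_insert_of_eq (hF.not_mem_dependencyUnion i) hne heq
    omega
  have hins : maxPF M b (insert i S) = lam := by
    rw [maxPF_insert hne]
    exact max_eq_left heq.ge
  simp only [blockGrowthFun, growthFun, ← hS, hJ, hins]
  refine tendsto_pi_nhds.2 fun y => ?_
  -- Mass still in the block has order `lam ^ t` and is negligible against the extra power of `t`.
  have he : Tendsto (fun t : ℕ =>
      (blockIncl b i).mulVec ((M.toSquareBlock b i ^ t).mulVec u) y /
        (lam ^ t * (t : ℝ) ^ (j + 1))) atTop (𝓝 0) := by
    have h1 := (tendsto_pi_nhds.1 (tendsto_mulVec (A := blockIncl b i) hcu)) y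
    have h2 : Tendsto (fun t : ℕ => (t : ℝ) ^ (j + 1)) atTop atTop :=
      (tendsto_pow_atTop (by omega)).comp tendsto_natCast_atTop_atTop
    refine (h1.div_atTop h2).congr fun t => ?_
    rw [Matrix.mulVec_smul, Pi.smul_apply, smul_eq_mul, ← div_div, div_eq_inv_mul _ (lam ^ t)]
  have key := tendsto_blockIncl_orbit (μ := lam) (J := j + 1) (y := y)
    (L := fun x => c * ((blockExit M b i).mulVec v x / lam) * W x y / ((j : ℝ) + 1)) he ?_
  · convert key using 2
    simp only [Pi.smul_apply, smul_eq_mul, zero_add, Finset.sum_apply, Finset.mul_sum]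
    refine Finset.sum_congr rfl fun x _ => ?_
    field_simp
  · intro x
    by_cases hx : b x ∈ S
    · have hG : Tendsto (fun s : ℕ =>
          (blockExit M b i).mulVec ((M.toSquareBlock b i ^ s).mulVec u) x / lam ^ (s + 1))
            atTop (𝓝 (c * ((blockExit M b i).mulVec v x / lam))) := by
        have := ((tendsto_pi_nhds.1 (tendsto_mulVec (A := blockExit M b i) hcu)) x).div_const lam
        simp only [Matrix.mulVec_smul, Pi.smul_apply, smul_eq_mul] at this
        rw [mul_div_assoc] at this
        refine this.congr fun t => ?_
        rw [pow_succ, ← div_div, div_eq_inv_mul _ (lam ^ t)]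
      have hWx := hW x hx y
      rw [← heq] at hWx
      refine (tendsto_convolution_of_tendsto hG hWx).congr fun t => ?_
      rw [sum_convolution_eq_pow_mul hlam.ne' (g := fun m => (M ^ m) y x),
        mul_div_mul_left _ _ (pow_ne_zero t hlam.ne')]
    · have h0 : ∀ s, (blockExit M b i).mulVec ((M.toSquareBlock b i ^ s).mulVec u) x = 0 :=
        fun s => blockExit_mulVec_eq_zero hM (toSquareBlock_pow_mulVec_nonneg hM hu s) hx
      rw [blockExit_mulVec_eq_zero hM (fun x => (hv x).le) hx]
      simp only [h0, zero_mul, Finset.sum_const_zero, zero_div, mul_zero]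
      exact tendsto_const_nhds

/-- The limits when the block has smaller eigenvalue than some block below it. -/
theorem exists_limit_of_lt_maxPF (hF : IsPrimitiveFrobeniusForm M b) (hM : ∀ x y, 0 ≤ M x y)
    (hne : (dependencyUnion M b i).Nonempty)
    (hCC : ConvergenceCondition M b (dependencyUnion M b i))
    (hlt : blockPF M b i < maxPF M b (dependencyUnion M b i)) (hlam : 0 ≤ blockPF M b i)
    {u : {x // b x = i} → ℝ} (hu : ∀ x, 0 ≤ u x)
    (hbd : ∃ K : ℝ, ∀ t x, (M.toSquareBlock b i ^ t).mulVec u x ≤ K * blockPF M b i ^ t)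
    (hpos : ∃ s, ∀ x, 0 < (M.toSquareBlock b i ^ s).mulVec u x) :
    ∃ w ∈ blockCone b (dependencyUnion M b i), IsEigenvector M w ∧
      Tendsto (fun t : ℕ => (blockGrowthFun M b i t)⁻¹ •
        (M ^ t).mulVec ((blockIncl b i).mulVec u)) atTop (𝓝 w) := by
  obtain ⟨W, hW⟩ := hCC.exists_isColumnLimit
  obtain ⟨K, hK⟩ := hbd
  obtain ⟨s₀, hs₀⟩ := hpos
  set S := dependencyUnion M b i with hS
  set lam := blockPF M b i with hlamdef
  set μ := maxPF M b S with hμdef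
  have hμ : 0 < μ := one_pos.trans_le hCC.1
  have hAu := toSquareBlock_pow_mulVec_nonneg (b := b) hM hu
  set f : ℕ → Fin n → ℝ := fun s =>
    (blockExit M b i).mulVec ((M.toSquareBlock b i ^ s).mulVec u) with hf
  have hf0 : ∀ s x, 0 ≤ f s x := fun s => (blockExit_mulVec_mem_blockCone hM (hAu s)).1
  have hfS : ∀ s x, b x ∉ S → f s x = 0 := fun s x => blockExit_mulVec_eq_zero hM (hAu s)
  have hq0 : 0 ≤ lam / μ := div_nonneg hlam hμ.le
  have hq1 : lam / μ < 1 := (div_lt_one hμ).2 hlt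
  have hsum : ∀ x, Summable fun s => f s x / μ ^ (s + 1) := by
    intro x
    refine ((summable_geometric_of_lt_one hq0 hq1).mul_left
      ((∑ y, blockExit M b i x y) * K / μ)).of_nonneg_of_le
        (fun s => div_nonneg (hf0 s x) (pow_pos hμ _).le) fun s => ?_
    have h1 : f s x ≤ ∑ y, blockExit M b i x y * (K * lam ^ s) :=
      mulVec_le_mulVec (w := fun _ => K * lam ^ s) (blockExit_nonneg hM i) (hK s) x
    rw [← Finset.sum_mul] at h1
    rw [div_le_iff₀ (pow_pos hμ _)]
    refine h1.trans_eq ?_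
    rw [div_pow, pow_succ]
    field_simp
  -- The total exiting mass, each exit discounted by its time. The orbit of `u` behaves
  -- asymptotically like that of `z`.
  set z : Fin n → ℝ := fun x => ∑' s, f s x / μ ^ (s + 1) with hz
  have hzS : z ∈ blockCone b S := by
    refine ⟨fun x => tsum_nonneg fun s => div_nonneg (hf0 s x) (pow_pos hμ _).le, fun x hx => ?_⟩
    simp only [hz, hfS _ x hx, zero_div, tsum_zero]
  -- The series `z` dominates its single term at `s₀`, a time at which the mass in the block is
  -- positive everywhere; this gives `ε = μ^(-(s₀+1))`.
  obtain ⟨hwc, hwe⟩ := hCC.columnLimit_isEigenvector hF hM hW hzS hs₀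
    (inv_pos.2 (pow_pos hμ (s₀ + 1))) fun x => by
      rw [← div_eq_inv_mul]
      exact (hsum x).le_tsum s₀ fun s _ => div_nonneg (hf0 s x) (pow_pos hμ _).le
  refine ⟨_, hwc, hwe, ?_⟩
  have hins : maxPF M b (insert i S) = μ := by
    rw [maxPF_insert hne]
    exact max_eq_right hlt.le
  simp only [blockGrowthFun, growthFun, ← hS, chainLength_insert_of_lt hne hlt, hins]
  refine tendsto_pi_nhds.2 fun y => ?_
  -- Only the upper bound `K * lam ^ t` is used, so a zero block with `lam = 0` is covered.
  have he : Tendsto (fun t : ℕ =>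
      (blockIncl b i).mulVec ((M.toSquareBlock b i ^ t).mulVec u) y /
        (μ ^ t * (t : ℝ) ^ (chainLength M b S - 1))) atTop (𝓝 0) := by
    have h1 := (tendsto_pow_atTop_nhds_zero_of_lt_one hq0 hq1).const_mul |K|
    rw [mul_zero] at h1
    refine squeeze_zero' (Eventually.of_forall fun t => div_nonneg
      ((blockIncl_mulVec_mem_blockCone (hAu t)).1 y) (by positivity)) ?_ h1
    filter_upwards [eventually_gt_atTop 0] with t ht
    have ht1 : (1 : ℝ) ≤ (t : ℝ) ^ (chainLength M b S - 1) :=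
      one_le_pow₀ (by exact_mod_cast ht)
    have h2 : (blockIncl b i).mulVec ((M.toSquareBlock b i ^ t).mulVec u) y ≤ |K| * lam ^ t := by
      rw [blockIncl_mulVec]
      split_ifs with hy
      · exact (hK t _).trans (mul_le_mul_of_nonneg_right (le_abs_self K) (pow_nonneg hlam t))
      · positivity
    rw [div_pow, ← mul_div_assoc]
    exact div_le_div₀ (by positivity) h2 (pow_pos hμ t)
      (le_mul_of_one_le_right (pow_pos hμ t).le ht1)
  have key := tendsto_blockIncl_orbit (μ := μ) (y := y) (L := fun x => z x * W x y) he ?_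
  · convert key using 2
    rw [zero_add, Finset.sum_apply]
    rfl
  · intro x
    by_cases hx : b x ∈ S
    · refine (tendsto_convolution_of_summable (hsum x) (hW x hx y)).congr fun t => ?_
      rw [sum_convolution_eq_pow_mul hμ.ne' (g := fun m => (M ^ m) y x),
        mul_div_mul_left _ _ (pow_ne_zero t hμ.ne')]
    · rw [hzS.2 x hx]
      have h0 := fun s => hfS s x hx
      simp only [hf] at h0
      simp only [h0, zero_mul, Finset.sum_const_zero, zero_div]
      exact tendsto_const_nhds

/-! ### The extended PF-eigenvector. -/

theorem isExtendedPFEigenvector_blockIncl {v : {x // b x = i} → ℝ} (hv : ∀ x, 0 < v x)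
    (hsum : ∑ x, v x = 1) (hAv : (M.toSquareBlock b i).mulVec v = blockPF M b i • v) :
    IsExtendedPFEigenvector M b i ((blockIncl b i).mulVec v) := by
  have hmem := blockIncl_mulVec_mem_blockCone (b := b) fun x => (hv x).le
  have hres : (fun x : {x // b x = i} => (blockIncl b i).mulVec v x.1) = v := by
    ext x
    rw [blockIncl_mulVec, dif_pos x.2]
  refine ⟨hmem, ?_, ?_⟩
  · simp only [abs_of_nonneg (hmem.1 _)]
    rw [← hsum]
    simp only [Matrix.mulVec, dotProduct]
    rw [Finset.sum_comm]
    simp [blockIncl]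
  · rw [hres, hasEigenvector_toLin'_iff]
    refine ⟨hAv, ?_⟩
    rintro rfl
    simp at hsum

theorem IsExtendedPFEigenvector.eq_blockIncl {v : {x // b x = i} → ℝ} (hv : ∀ x, 0 < v x)
    (hsum : ∑ x, v x = 1) (hAv : (M.toSquareBlock b i).mulVec v = blockPF M b i • v)
    (huniq : ∀ w : {x // b x = i} → ℝ, (∀ x, 0 ≤ w x) → w ≠ 0 →
      (M.toSquareBlock b i).mulVec w = blockPF M b i • w → ∃ c : ℝ, w = c • v)
    {v' : Fin n → ℝ} (hv' : IsExtendedPFEigenvector M b i v') :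
    v' = (blockIncl b i).mulVec v := by
  obtain ⟨hmem, hnorm, heig⟩ := hv'
  obtain ⟨heig, hne⟩ := hasEigenvector_toLin'_iff.1 heig
  obtain ⟨c, hc⟩ := huniq _ (fun x => hmem.1 x) hne heig
  have h1 : v' = c • (blockIncl b i).mulVec v := by
    rw [← Matrix.mulVec_smul, ← hc, blockIncl_mulVec_restrict hmem]
  have h2 := (isExtendedPFEigenvector_blockIncl hv hsum hAv).2.1
  have hinc := (blockIncl_mulVec_mem_blockCone (b := b) fun x => (hv x).le).1
  have hc1 : c = 1 := by
    simp only [abs_of_nonneg (hinc _)] at h2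
    simp only [abs_of_nonneg (hmem.1 _)] at hnorm
    rw [h1] at hnorm
    simpa only [Pi.smul_apply, smul_eq_mul, ← Finset.mul_sum, h2, mul_one] using hnorm
  rw [h1, hc1, one_smul]

end Limits

end BlockFrobenius

/-! ### Assembly of the three cases. -/

open BlockFrobenius in
theorem proposition5p4 {n r : ℕ} (M : Matrix (Fin n) (Fin n) ℝ) (b : Fin n → Fin r)
    (hM : ∀ x y, ∃ m : ℕ, M x y = m)
    (hF : IsPrimitiveFrobeniusForm M b)
    (hcol : ∀ y, ∃ x, M x y ≠ 0)
    (i : Fin r)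
    (hne : (dependencyUnion M b i).Nonempty)
    (hCC : ConvergenceCondition M b (dependencyUnion M b i)) :
    -- for every non-zero vector in the cone of `B` the sequence converges to an eigenvector
    (∀ v₀ ∈ blockCone b {i}, v₀ ≠ 0 → ∃ w, IsEigenvector M w ∧
      Tendsto (fun t : ℕ => (blockGrowthFun M b i t)⁻¹ • (M ^ t).mulVec v₀) atTop (𝓝 w)) ∧
    -- the extended PF-eigenvector of `B`, and the description of the limit in the three cases
    ∃ vinf, IsExtendedPFEigenvector M b i vinf ∧
      (∀ v', IsExtendedPFEigenvector M b i v' → v' = vinf) ∧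
      (maxPF M b (dependencyUnion M b i) < blockPF M b i →
        ∃! w₀, w₀ ∈ blockCone b (dependencyUnion M b i) ∧ IsEigenvector M (vinf + w₀) ∧
          ∀ v₀ ∈ blockCone b {i}, v₀ ≠ 0 → ∃ c : ℝ, 0 < c ∧
            Tendsto (fun t : ℕ => (blockGrowthFun M b i t)⁻¹ • (M ^ t).mulVec v₀) atTop
              (𝓝 (c • (vinf + w₀)))) ∧
      (blockPF M b i = maxPF M b (dependencyUnion M b i) →
        ∃ uinf ∈ blockCone b (dependencyUnion M b i), IsEigenvector M uinf ∧
          ∀ v₀ ∈ blockCone b {i}, v₀ ≠ 0 → ∃ c : ℝ, 0 < c ∧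
            Tendsto (fun t : ℕ => (blockGrowthFun M b i t)⁻¹ • (M ^ t).mulVec v₀) atTop
              (𝓝 (c • uinf))) ∧
      (blockPF M b i < maxPF M b (dependencyUnion M b i) →
        ∀ v₀ ∈ blockCone b {i}, v₀ ≠ 0 →
          ∃ w ∈ blockCone b (dependencyUnion M b i), IsEigenvector M w ∧
            Tendsto (fun t : ℕ => (blockGrowthFun M b i t)⁻¹ • (M ^ t).mulVec v₀) atTop (𝓝 w)) := by
  have hM0 : ∀ x y, 0 ≤ M x y := fun x y => by
    obtain ⟨m, hm⟩ := hM x y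
    rw [hm]
    exact m.cast_nonneg
  have := hF.nonempty_block i
  obtain ⟨hlam, v, hv, hsum, hAv, huniq, hconv, hbd, hpos⟩ :=
    exists_normalized_pfEigenvector (hF.diagonal i)
  change 0 ≤ blockPF M b i at hlam
  have hμ : 0 < maxPF M b (dependencyUnion M b i) := one_pos.trans_le hCC.1
  have hext := isExtendedPFEigenvector_blockIncl hv hsum hAv
  have hres : ∀ v₀ ∈ blockCone b {i}, v₀ ≠ 0 → ∃ u : {x // b x = i} → ℝ,
      (∀ x, 0 ≤ u x) ∧ u ≠ 0 ∧ v₀ = (blockIncl b i).mulVec u := by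
    intro v₀ h h0
    refine ⟨fun x => v₀ x.1, fun x => h.1 x, fun hz => h0 ?_, (blockIncl_mulVec_restrict h).symm⟩
    rw [← blockIncl_mulVec_restrict h, hz, Matrix.mulVec_zero]
  have hv0 : (blockIncl b i).mulVec v ≠ 0 := by
    intro h
    have := hext.2.1
    simp [h] at this
  have hgt : maxPF M b (dependencyUnion M b i) < blockPF M b i →
      ∃ w₀, w₀ ∈ blockCone b (dependencyUnion M b i) ∧
        IsEigenvector M ((blockIncl b i).mulVec v + w₀) ∧
          ∀ v₀ ∈ blockCone b {i}, v₀ ≠ 0 → ∃ c : ℝ, 0 < c ∧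
            Tendsto (fun t : ℕ => (blockGrowthFun M b i t)⁻¹ • (M ^ t).mulVec v₀) atTop
              (𝓝 (c • ((blockIncl b i).mulVec v + w₀))) := by
    intro hlt
    obtain ⟨w₀, hw, hwe, hlim⟩ :=
      exists_limit_of_maxPF_lt hF hM0 hne hCC hlt hv (hconv (hμ.trans hlt))
    refine ⟨w₀, hw, hwe, fun v₀ h h0 => ?_⟩
    obtain ⟨u, hu, hu0, rfl⟩ := hres v₀ h h0
    exact hlim u hu hu0
  have heq : blockPF M b i = maxPF M b (dependencyUnion M b i) →
        ∃ uinf ∈ blockCone b (dependencyUnion M b i), IsEigenvector M uinf ∧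
          ∀ v₀ ∈ blockCone b {i}, v₀ ≠ 0 → ∃ c : ℝ, 0 < c ∧
            Tendsto (fun t : ℕ => (blockGrowthFun M b i t)⁻¹ • (M ^ t).mulVec v₀) atTop
              (𝓝 (c • uinf)) := by
    intro heq
    obtain ⟨w, hw, hwe, hlim⟩ :=
      exists_limit_of_eq_maxPF hF hM0 hne hCC heq hv (hconv (by
        change 0 < blockPF M b i
        rwa [heq]))
    refine ⟨w, hw, hwe, fun v₀ h h0 => ?_⟩
    obtain ⟨u, hu, hu0, rfl⟩ := hres v₀ h h0
    exact hlim u hu hu0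
  have hlt : blockPF M b i < maxPF M b (dependencyUnion M b i) →
        ∀ v₀ ∈ blockCone b {i}, v₀ ≠ 0 →
          ∃ w ∈ blockCone b (dependencyUnion M b i), IsEigenvector M w ∧
            Tendsto (fun t : ℕ => (blockGrowthFun M b i t)⁻¹ • (M ^ t).mulVec v₀) atTop
              (𝓝 w) := by
    intro hlt v₀ h h0
    obtain ⟨u, hu, hu0, rfl⟩ := hres v₀ h h0
    exact exists_limit_of_lt_maxPF hF hM0 hne hCC hlt hlam hu (hbd u hu) (hpos u hu hu0)
  have hscale : ∀ {c : ℝ} {w : Fin n → ℝ}, 0 < c → IsEigenvector M w →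
      IsEigenvector M (c • w) := by
    rintro c w hc ⟨μ, hw⟩
    obtain ⟨h1, h2⟩ := hasEigenvector_toLin'_iff.1 hw
    exact ⟨μ, hasEigenvector_toLin'_iff.2
      ⟨by rw [Matrix.mulVec_smul, h1, smul_comm], smul_ne_zero hc.ne' h2⟩⟩
  refine ⟨fun v₀ h h0 => ?_, (blockIncl b i).mulVec v, hext,
    fun v' hv' => hv'.eq_blockIncl hv hsum hAv huniq, fun hlt' => ?_, heq, hlt⟩
  · rcases lt_trichotomy (blockPF M b i) (maxPF M b (dependencyUnion M b i)) with h1 | h1 | h1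
    · obtain ⟨w, -, hw, hlim⟩ := hlt h1 v₀ h h0
      exact ⟨w, hw, hlim⟩
    · obtain ⟨w, -, hw, hlim⟩ := heq h1
      obtain ⟨c, hc, hlim⟩ := hlim v₀ h h0
      exact ⟨_, hscale hc hw, hlim⟩
    · obtain ⟨w, -, hw, hlim⟩ := hgt h1
      obtain ⟨c, hc, hlim⟩ := hlim v₀ h h0
      exact ⟨_, hscale hc hw, hlim⟩
  · obtain ⟨w, hw, hwe, hlim⟩ := hgt hlt'
    refine ⟨w, ⟨hw, hwe, hlim⟩, ?_⟩
    rintro w' ⟨hw', -, hlim'⟩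
    -- Both descriptions give the same limit for the orbit of the PF-eigenvector. In block `i` the
    -- correction vectors vanish and `v` is positive, which forces `c' = c` and then `w' = w`.
    obtain ⟨c, hc, h1⟩ := hlim _ hext.1 hv0
    obtain ⟨c', hc', h2⟩ := hlim' _ hext.1 hv0
    have h3 := tendsto_nhds_unique h2 h1
    obtain ⟨x₀⟩ := this
    have hi : b x₀ ∉ dependencyUnion M b i := by
      rw [x₀.2]
      exact hF.not_mem_dependencyUnion i
    have h4 := congrFun h3 x₀
    simp only [Pi.smul_apply, Pi.add_apply, hw.2 _ hi, hw'.2 _ hi, add_zero, smul_eq_mul] at h4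
    rw [blockIncl_mulVec, dif_pos x₀.2] at h4
    have h5 : c' = c := mul_right_cancel₀ (hv x₀).ne' h4
    rw [h5] at h3
    exact add_left_cancel (smul_right_injective _ hc.ne' h3)
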